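/- Let $\phi(t)=t$, $p=1$ (linear networks) or $\phi(t)=\max\{t,0\}$, $p=\tfrac12$ (ReLU networks). For depth $L$, width $d$, data $x_i\in\mathbb R^{d_{in}}$, $y_i\in\mathbb R^{d_{out}}$ $(i=1,\dots,n)$ and matrices $A\in\mathbb R^{d\times d_{in}}$, $B\in\mathbb R^{d_{out}\times d}$, consider the loss of the hidden weights $W=(W^1,\dots,W^L)$, $W^\ell\in\mathbb R^{d\times d}$, $$\mathcal L(W)=\frac1{2n}\sum_{i=1}^n\bigl\|y_i-B D_i^L W^L D_i^{L-1}W^{L-1}\cdots W^1D_i^0A x_i\bigr\|_2^2 ,$$ where $D_i^\ell$ is the diagonal matrix of activation gates at layer $\ell$ for the input $x_i$: the identity for linear networks; for ReLU networks the entry is $1$ if the preactivation is positive and $0$ otherwise. All entries of $W^1,\dots,W^L$ are i.i.d. with a law $\mathcal P$ that is symmetric around $0$ and has variance $\sigma^2$ and finite fourth moment. $A$ and $B$ are fixed, or more generally random and independent of $W$. Let $H$ be the $Ld^2\times Ld^2$ Hessian of $\mathcal L$ with respect to $W$ at this initialization, the gates being treated as constants under differentiation, and let $|\lambda_{\max}|$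 be the largest absolute value of an eigenvalue of $H$. Assume $\|y_i\|_2\le K$ and $\mathbb E[\|B\|_F^2\|Ax_i\|_2^2]\le K^2$ for all $i$, and $pd\sigma^2\ge s_0>0$. (1) If $pd\sigma^2\le1$ (vanishing or stable regime), then $$\mathbb E\,|\lambda_{\max}|\le L\,d\cdot C\,(pd\sigma^2)^{L/2}$$ with a constant $C$ that depends only on $K$ and $s_0$ (for each of the two kinds of network), not on $L$, $d$, $n$, $d_{in}$, $d_{out}$ or $\mathcal P$. That is, $\mathbb E|\lambda^{\rm linear}_{\max}|\le Ld\cdot\mathcal O((d\sigma^2)^{L/2})$ and $\mathbb E|\lambda^{\rm ReLU}_{\max}|\le Ld\cdot\mathcal O((\tfrac d2\sigma^2)^{L/2})$. (2) If, instead, only $pd\sigma^2\le s_1$ for some $s_1$, the same bound holds with a constant $C$ that depends only on $K,s_0,s_1$ and $L$. (3) For linear networks, and for ReLU networks when $\mathcal P$ has no atoms, the loss is almost surely twice differentiable at the initialization in the sense of being $C^2$ near it (no lower or upper bound on $pd\sigma^2$ and no bound $K$ is needed here), and its Hessian there is $H$. -/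

import Mathlib

open MeasureTheory ProbabilityTheory
open scoped Matrix ENNReal Topology

universe u

noncomputable section

/-- The two nonlinearities: `φ(t) = t` (linear networks) and `φ(t) = max t 0` (ReLU networks). -/
inductive Activation where
  | linear : Activation
  | relu : Activation

namespace Activation

/-- The nonlinearity itself. -/
def fn : Activation → ℝ → ℝ
  | linear, t => t
  | relu, t => max t 0

/-- The activation gate, `1` or `0`, that a preactivation `t` produces. -/
def gate : Activation → ℝ → ℝ
  | linear, _ => 1
  | relu, t => if 0 < t then 1 else 0

/-- The parameter `p`: `1` for linear networks, `1/2` for ReLU networks. -/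
def p : Activation → ℝ
  | linear => 1
  | relu => 1 / 2

/-- Multiplying by the gate is the same as applying the nonlinearity. -/
theorem gate_mul_self (act : Activation) (t : ℝ) : act.gate t * t = act.fn t := by
  cases act with
  | linear => simp [gate, fn]
  | relu =>
    by_cases h : 0 < t
    · simp [gate, fn, h, h.le]
    · simp [gate, fn, h, not_lt.mp h]

end Activation

/-- Index set of the weights: `(ℓ, i, j)` stands for the entry `(i, j)` of the weight matrix of
the hidden layer number `ℓ + 1`. -/
abbrev WeightIndex (L d : ℕ) : Type := Fin L × Fin d × Fin d

/-- The weight matrix with number `k + 1` (only used for `k < L`). -/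
def weightMatrix {L d : ℕ} (w : WeightIndex L d → ℝ) (k : ℕ) : Matrix (Fin d) (Fin d) ℝ :=
  Matrix.of fun i j => if h : k < L then w (⟨k, h⟩, i, j) else 0

/-- Preactivations for the network input `z = A x`: `g⁰ = z`, `gᵏ⁺¹ = Wᵏ⁺¹ φ(gᵏ)`. -/
def preact (act : Activation) {L d : ℕ} (w : WeightIndex L d → ℝ) (z : Fin d → ℝ) :
    ℕ → Fin d → ℝ
  | 0 => z
  | k + 1 => weightMatrix w k *ᵥ fun j => act.fn (preact act w z k j)

/-- Forward pass with prescribed gates `D`: `z ↦ Wᵏ Dᵏ⁻¹ Wᵏ⁻¹ ⋯ W¹ D⁰ z`. -/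
def gatedForward {L d : ℕ} (D : ℕ → Fin d → ℝ) (w : WeightIndex L d → ℝ) (z : Fin d → ℝ) :
    ℕ → Fin d → ℝ
  | 0 => z
  | k + 1 => weightMatrix w k *ᵥ fun j => D k j * gatedForward D w z k j

/-- The square loss `1/(2n) ∑ᵢ ‖yᵢ - B φ(g^L(A xᵢ))‖²` as a function of the hidden weights. -/
def mlpLoss (act : Activation) {L d din dout n : ℕ}
    (A : Matrix (Fin d) (Fin din) ℝ) (B : Matrix (Fin dout) (Fin d) ℝ)
    (x : Fin n → Fin din → ℝ) (y : Fin n → Fin dout → ℝ) (w : WeightIndex L d → ℝ) : ℝ :=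
  1 / (2 * (n : ℝ)) * ∑ i, ∑ o,
    (y i o - (B *ᵥ fun j => act.fn (preact act w (A *ᵥ x i) L j)) o) ^ 2

/-- The square loss `1/(2n) ∑ᵢ ‖yᵢ - B D^L W^L D^{L-1} ⋯ W¹ D⁰ A xᵢ‖²` at the weights `w`, where
for every sample the gates `D⁰, …, D^L` are those produced by the weights `w₀`. -/
def gatedLoss (act : Activation) {L d din dout n : ℕ}
    (A : Matrix (Fin d) (Fin din) ℝ) (B : Matrix (Fin dout) (Fin d) ℝ)
    (x : Fin n → Fin din → ℝ) (y : Fin n → Fin dout → ℝ) (w₀ w : WeightIndex L d → ℝ) : ℝ :=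
  1 / (2 * (n : ℝ)) * ∑ i, ∑ o,
    (y i o - (B *ᵥ fun j => act.gate (preact act w₀ (A *ᵥ x i) L j) *
      gatedForward (fun k m => act.gate (preact act w₀ (A *ᵥ x i) k m)) w (A *ᵥ x i) L j) o) ^ 2

/-- The Hessian matrix of `f` at `w`. -/
def hessianMatrix {ι : Type*} [Fintype ι] [DecidableEq ι] (f : (ι → ℝ) → ℝ) (w : ι → ℝ) :
    Matrix ι ι ℝ :=
  Matrix.of fun a b => iteratedFDeriv ℝ 2 f w ![Pi.single a 1, Pi.single b 1]

/-- The Hessian of the network loss at `w`, with the activation gates at `w` treated as constant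
matrices under differentiation. This is defined for all `w`; it is the Hessian of `mlpLoss` for
linear networks, and for ReLU networks wherever the gates are locally constant. -/
def networkHessian (act : Activation) {L d din dout n : ℕ}
    (A : Matrix (Fin d) (Fin din) ℝ) (B : Matrix (Fin dout) (Fin d) ℝ)
    (x : Fin n → Fin din → ℝ) (y : Fin n → Fin dout → ℝ) (w : WeightIndex L d → ℝ) :
    Matrix (WeightIndex L d) (WeightIndex L d) ℝ :=
  hessianMatrix (gatedLoss act A B x y w) w

/-- `P` is a probability law on `ℝ`, symmetric around zero, with standard deviation `σ` and finite
fourth moment. -/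
structure IsInitLaw (P : Measure ℝ) (σ : ℝ) : Prop where
  isProbabilityMeasure : IsProbabilityMeasure P
  symmetric : P.map (fun t => -t) = P
  fourth_moment : MemLp id 4 P
  sigma_nonneg : 0 ≤ σ
  variance_eq : variance id P = σ ^ 2

/-- A randomly initialized network of depth `L` and width `d` together with its data set: the
entries of the hidden weight matrices are i.i.d. with law `P`. The input and output matrices are
independent of them and otherwise arbitrary (for instance constant). -/
structure RandomNetwork (L d : ℕ) (P : Measure ℝ) where
  /-- the sample space -/
  Ω : Type u
  [measurableSpace : MeasurableSpace Ω]
  /-- the underlying probability -/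
  μ : Measure Ω
  [isProbabilityMeasure : IsProbabilityMeasure μ]
  /-- input dimension -/
  din : ℕ
  /-- output dimension -/
  dout : ℕ
  /-- number of data points -/
  n : ℕ
  /-- inputs -/
  x : Fin n → Fin din → ℝ
  /-- targets -/
  y : Fin n → Fin dout → ℝ
  /-- input matrix -/
  A : Ω → Matrix (Fin d) (Fin din) ℝ
  /-- output matrix -/
  B : Ω → Matrix (Fin dout) (Fin d) ℝ
  /-- hidden weights -/
  W : Ω → WeightIndex L d → ℝ
  measurable_A : ∀ i j, Measurable fun ω => A ω i j
  measurable_B : ∀ i j, Measurable fun ω => B ω i j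
  measurable_W : ∀ a, Measurable fun ω => W ω a
  law_W : ∀ a, μ.map (fun ω => W ω a) = P
  indep_W : iIndepFun (fun a ω => W ω a) μ
  indep_AB_W : IndepFun (fun ω => ((fun i j => A ω i j, fun i j => B ω i j) :
    (Fin d → Fin din → ℝ) × (Fin dout → Fin d → ℝ))) W μ

attribute [instance] RandomNetwork.measurableSpace RandomNetwork.isProbabilityMeasure

namespace RandomNetwork

variable {L d : ℕ} {P : Measure ℝ}

/-- The loss as a function of the hidden weights, at the outcome `ω` of the input and output
matrices. -/
def loss (N : RandomNetwork L d P) (act : Activation) (ω : N.Ω) (w : WeightIndex L d → ℝ) : ℝ :=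
  mlpLoss act (N.A ω) (N.B ω) N.x N.y w

/-- The Hessian of the loss at the random initialization. -/
def hessian (N : RandomNetwork L d P) (act : Activation) (ω : N.Ω) :
    Matrix (WeightIndex L d) (WeightIndex L d) ℝ :=
  networkHessian act (N.A ω) (N.B ω) N.x N.y (N.W ω)

/-- Expectation of the largest absolute value of an eigenvalue of the Hessian at initialization. -/
def expectedMaxEigenvalue (N : RandomNetwork L d P) (act : Activation) : ℝ≥0∞ :=
  ∫⁻ ω, spectralRadius ℝ (N.hessian act ω) ∂N.μ

/-- The data and the outer layers are bounded by `K`: `‖yᵢ‖ ≤ K` and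
`E[‖B‖_F² ‖A xᵢ‖²] ≤ K²`; for constant `A`, `B` the latter is `‖B‖_F ‖A xᵢ‖ ≤ K`. -/
structure BoundedBy (N : RandomNetwork L d P) (K : ℝ) : Prop where
  nonneg : 0 ≤ K
  target : ∀ i, ∑ o, N.y i o ^ 2 ≤ K ^ 2
  outer : ∀ i, ∫⁻ ω, ENNReal.ofReal ((∑ o, ∑ j, N.B ω o j ^ 2) * ∑ j, (N.A ω *ᵥ N.x i) j ^ 2) ∂N.μ
    ≤ ENNReal.ofReal (K ^ 2)

end RandomNetwork

end

/-! With the gates frozen, the output is multilinear in the layers. Its derivative in one weight is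
therefore the same network with that layer replaced by an elementary matrix. A mixed second
derivative replaces two layers, and vanishes if both weights lie in one layer. The Hessian is an
average of Gauss-Newton terms `J Jᵀ` and residual terms `r h`. On a unit vector, Cauchy-Schwarz and
AM-GM with a free weight `α` bound the quadratic form by Frobenius norms of `J` and `h` and by `α
r²` (`spectralRadius_networkHessian_le`).

These are sums of squares, so their expectations can be followed layer by layer. Put `s = p d σ²`.
An untouched random layer multiplies the expected squared norm by at most `s`
(`lintegral_layer_le`): a sign flip of one row of weights closes an open ReLU gate and preserves the
square, which gives `p = 1/2`. A layer replaced by elementary matrices, summed over all of them,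
contributes at most `d` instead. The state, its first and its second derivatives thus have energies
at most `s^L`, `L d s^(L-1)` and `L² d² s^(L-2)`, times `‖A x‖²`. The choice `α = L d s^(L/2)`
balances the terms and makes all of them `L d s^(L/2)` up to constants.

For differentiability, an atomless law makes every preactivation nonzero almost surely, except at
neurons all of whose inputs vanish. Those inputs vanish in a whole neighbourhood, so the gates are
locally constant and the true loss agrees locally with the gated one. -/

/-! ### Derivatives of the network with frozen gates -/

/-- The weights `w` with layer `ℓ` replaced by the corresponding layer of `u`. -/
def setLayer {L d : ℕ} (w : WeightIndex L d → ℝ) (ℓ : Fin L) (u : WeightIndex L d → ℝ) :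
    WeightIndex L d → ℝ :=
  fun a => if a.1 = ℓ then u a else w a

/-- The unit vector in the direction of the weight with index `a`. -/
def unitWeight {L d : ℕ} (a : WeightIndex L d) : WeightIndex L d → ℝ := Pi.single a 1

theorem gatedForward_congr {L d : ℕ} {D D' : ℕ → Fin d → ℝ} {w w' : WeightIndex L d → ℝ}
    (z : Fin d → ℝ) (k : ℕ) (hD : ∀ j < k, D j = D' j)
    (hw : ∀ a : WeightIndex L d, a.1.val < k → w a = w' a) :
    gatedForward D w z k = gatedForward D' w' z k := by
  induction k with
  | zero => rfl
  | succ k ih =>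
    have h1 := ih (fun j hj => hD j (by omega)) (fun a ha => hw a (by omega))
    have h2 : weightMatrix w k = weightMatrix w' k := by
      ext i j
      simp only [weightMatrix, Matrix.of_apply]
      split_ifs with h
      · exact hw _ (by simp)
      · rfl
    simp only [gatedForward, h1, h2, hD k (by omega)]

theorem weightMatrix_setLayer_of_ne {L d : ℕ} (w u : WeightIndex L d → ℝ) {ℓ : Fin L} {k : ℕ}
    (h : k ≠ ℓ) : weightMatrix (setLayer w ℓ u) k = weightMatrix w k := by
  ext i j
  simp only [weightMatrix, Matrix.of_apply, setLayer]
  split_ifs with h1 h2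
  · exact absurd (congrArg Fin.val h2) h
  · rfl
  · rfl

theorem weightMatrix_setLayer_self {L d : ℕ} (w u : WeightIndex L d → ℝ) (ℓ : Fin L) :
    weightMatrix (setLayer w ℓ u) ℓ = weightMatrix u ℓ := by
  ext i j
  simp [weightMatrix, setLayer]

theorem weightMatrix_unitWeight_mulVec {L d : ℕ} (a : WeightIndex L d) (v : Fin d → ℝ) :
    weightMatrix (unitWeight a) a.1 *ᵥ v = fun i => if i = a.2.1 then v a.2.2 else 0 := by
  obtain ⟨ℓ, i, j⟩ := a
  ext i'
  simp only [weightMatrix, Matrix.mulVec, dotProduct, Matrix.of_apply, unitWeight,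
    Pi.single_apply]
  by_cases h : i' = i
  · subst h
    simp
  · simp [h]

theorem gatedForward_setLayer_of_le {L d : ℕ} (D : ℕ → Fin d → ℝ) (w u : WeightIndex L d → ℝ)
    (z : Fin d → ℝ) {ℓ : Fin L} {k : ℕ} (h : k ≤ ℓ) :
    gatedForward D (setLayer w ℓ u) z k = gatedForward D w z k :=
  gatedForward_congr z k (fun _ _ => rfl) fun a ha => by
    rw [setLayer, if_neg]
    intro h'
    rw [h'] at ha
    omega

theorem weightMatrix_add_smul {L d : ℕ} (w u : WeightIndex L d → ℝ) (t : ℝ) (k : ℕ) :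
    weightMatrix (w + t • u) k = weightMatrix w k + t • weightMatrix u k := by
  ext i j
  simp only [weightMatrix, Matrix.of_apply, Matrix.add_apply, Matrix.smul_apply]
  split_ifs <;> simp

theorem weightMatrix_unitWeight_of_ne {L d : ℕ} (a : WeightIndex L d) {k : ℕ} (h : k ≠ a.1) :
    weightMatrix (unitWeight a) k = 0 := by
  ext i j
  simp only [weightMatrix, Matrix.of_apply, unitWeight, Matrix.zero_apply]
  split_ifs with hk
  · rw [Pi.single_apply, if_neg]
    rintro rfl
    exact h rfl
  · rfl

/-- The gated forward pass is affine in every single weight. -/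
theorem gatedForward_add_smul_unitWeight {L d : ℕ} (D : ℕ → Fin d → ℝ)
    (w : WeightIndex L d → ℝ) (z : Fin d → ℝ) (a : WeightIndex L d) (t : ℝ) (k : ℕ) :
    gatedForward D (w + t • unitWeight a) z k = gatedForward D w z k +
      t • if a.1.val < k then gatedForward D (setLayer w a.1 (unitWeight a)) z k else 0 := by
  induction k with
  | zero => simp [gatedForward]
  | succ k ih =>
    simp only [gatedForward, ih, weightMatrix_add_smul]
    rcases lt_trichotomy k a.1.val with h | h | h
    · rw [if_neg (by omega), if_neg (by omega), weightMatrix_unitWeight_of_ne a h.ne]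
      simp
    · rw [if_neg (by omega), if_pos (by omega)]
      subst h
      rw [weightMatrix_setLayer_self, gatedForward_setLayer_of_le _ _ _ _ le_rfl,
        Matrix.add_mulVec, Matrix.smul_mulVec]
      simp
    · rw [if_pos h, if_pos (by omega), weightMatrix_unitWeight_of_ne a h.ne',
        weightMatrix_setLayer_of_ne _ _ h.ne', smul_zero, add_zero, ← Matrix.mulVec_smul,
        ← Matrix.mulVec_add]
      congr 1
      ext j
      simp
      ring

theorem setLayer_add_smul_of_eq {L d : ℕ} (w u : WeightIndex L d → ℝ) {a : WeightIndex L d}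
    {ℓ : Fin L} (h : a.1 = ℓ) (t : ℝ) :
    setLayer (w + t • unitWeight a) ℓ u = setLayer w ℓ u := by
  ext b
  simp only [setLayer, unitWeight, Pi.add_apply, Pi.smul_apply]
  split_ifs with hb
  · rfl
  · rw [Pi.single_apply, if_neg]
    · simp
    · rintro rfl
      exact hb h

theorem setLayer_add_smul_of_ne {L d : ℕ} (w u : WeightIndex L d → ℝ) {a : WeightIndex L d}
    {ℓ : Fin L} (h : a.1 ≠ ℓ) (t : ℝ) :
    setLayer (w + t • unitWeight a) ℓ u = setLayer w ℓ u + t • unitWeight a := by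
  ext b
  simp only [setLayer, unitWeight, Pi.add_apply, Pi.smul_apply]
  split_ifs with hb
  · rw [Pi.single_apply, if_neg]
    · simp
    · rintro rfl
      exact h hb
  · rfl

theorem setLayer_comm {L d : ℕ} (w u v : WeightIndex L d → ℝ) {ℓ m : Fin L} (h : ℓ ≠ m) :
    setLayer (setLayer w ℓ u) m v = setLayer (setLayer w m v) ℓ u := by
  ext b
  simp only [setLayer]
  split_ifs with h1 h2
  · exact absurd (h2.symm.trans h1) h
  all_goals rfl

theorem contDiff_gatedForward {L d : ℕ} (D : ℕ → Fin d → ℝ) (z : Fin d → ℝ) (k : ℕ) (i : Fin d)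
    {n : WithTop ℕ∞} : ContDiff ℝ n fun w : WeightIndex L d → ℝ => gatedForward D w z k i := by
  induction k generalizing i with
  | zero => exact contDiff_const
  | succ k ih =>
    simp only [gatedForward, Matrix.mulVec, dotProduct, weightMatrix, Matrix.of_apply]
    refine ContDiff.sum fun j _ => ContDiff.mul ?_ (contDiff_const.mul (ih j))
    split_ifs
    · exact contDiff_apply ℝ ℝ _
    · exact contDiff_const

/-- Output of the network with prescribed gates. -/
def gatedOutput {L d dout : ℕ} (B : Matrix (Fin dout) (Fin d) ℝ) (D : ℕ → Fin d → ℝ)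
    (z : Fin d → ℝ) (w : WeightIndex L d → ℝ) : Fin dout → ℝ :=
  B *ᵥ fun j => D L j * gatedForward D w z L j

theorem contDiff_gatedOutput {L d dout : ℕ} (B : Matrix (Fin dout) (Fin d) ℝ)
    (D : ℕ → Fin d → ℝ) (z : Fin d → ℝ) (o : Fin dout) {n : WithTop ℕ∞} :
    ContDiff ℝ n fun w : WeightIndex L d → ℝ => gatedOutput B D z w o := by
  simp only [gatedOutput, Matrix.mulVec, dotProduct]
  exact ContDiff.sum fun j _ => contDiff_const.mul (contDiff_const.mul
    (contDiff_gatedForward D z L j))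

theorem gatedOutput_add_smul_unitWeight {L d dout : ℕ} (B : Matrix (Fin dout) (Fin d) ℝ)
    (D : ℕ → Fin d → ℝ) (z : Fin d → ℝ) (w : WeightIndex L d → ℝ) (a : WeightIndex L d) (t : ℝ) :
    gatedOutput B D z (w + t • unitWeight a) =
      gatedOutput B D z w + t • gatedOutput B D z (setLayer w a.1 (unitWeight a)) := by
  simp only [gatedOutput, gatedForward_add_smul_unitWeight, a.1.isLt, if_true]
  rw [← Matrix.mulVec_smul, ← Matrix.mulVec_add]
  congr 1
  ext j
  simp
  ring

/-- Along a single weight the output is affine, so a partial derivative is read off as a slope and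
no matrix product has to be differentiated. -/
theorem fderiv_apply_of_add_smul {ι : Type*} [Fintype ι] {f : (ι → ℝ) → ℝ} {w e : ι → ℝ}
    {c : ℝ} (hf : DifferentiableAt ℝ f w) (h : ∀ t : ℝ, f (w + t • e) = f w + t * c) :
    fderiv ℝ f w e = c := by
  have h1 : HasDerivAt (fun t : ℝ => f (w + t • e)) (fderiv ℝ f w e) 0 := by
    have h2 : HasDerivAt (fun t : ℝ => w + t • e) e 0 := by
      simpa using ((hasDerivAt_id (0 : ℝ)).smul_const e).const_add w
    have h3 : HasFDerivAt f (fderiv ℝ f w) (w + (0 : ℝ) • e) := by simpa using hf.hasFDerivAt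
    exact h3.comp_hasDerivAt _ h2
  have h4 : HasDerivAt (fun t : ℝ => f (w + t • e)) c 0 := by
    simp only [h]
    simpa using ((hasDerivAt_id (0 : ℝ)).mul_const c).const_add (f w)
  exact h1.unique h4

/-- The second derivatives of the output in the weights `a`, `b`. -/
def gatedOutput₂ {L d dout : ℕ} (B : Matrix (Fin dout) (Fin d) ℝ) (D : ℕ → Fin d → ℝ)
    (z : Fin d → ℝ) (w : WeightIndex L d → ℝ) (a b : WeightIndex L d) : Fin dout → ℝ :=
  if a.1 = b.1 then 0 else
    gatedOutput B D z (setLayer (setLayer w a.1 (unitWeight a)) b.1 (unitWeight b))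

theorem fderiv_gatedOutput {L d dout : ℕ} (B : Matrix (Fin dout) (Fin d) ℝ)
    (D : ℕ → Fin d → ℝ) (z : Fin d → ℝ) (w : WeightIndex L d → ℝ) (a : WeightIndex L d)
    (o : Fin dout) :
    fderiv ℝ (fun w => gatedOutput B D z w o) w (unitWeight a) =
      gatedOutput B D z (setLayer w a.1 (unitWeight a)) o :=
  fderiv_apply_of_add_smul
    ((contDiff_gatedOutput B D z o (n := 1)).differentiable (by simp)).differentiableAt
    fun t => by rw [gatedOutput_add_smul_unitWeight]; rfl

theorem contDiff_setLayer {L d : ℕ} (ℓ : Fin L) (u : WeightIndex L d → ℝ) {n : WithTop ℕ∞} :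
    ContDiff ℝ n fun w : WeightIndex L d → ℝ => setLayer w ℓ u := by
  rw [contDiff_pi]
  intro a
  simp only [setLayer]
  split_ifs
  · exact contDiff_const
  · exact contDiff_apply ℝ ℝ a

/-- A layer that has already been replaced does not see a change of its own weights, which gives
zero for two weights of one layer. For different layers the network with layer `b.1` replaced is
again affine in the weight `a`. -/
theorem fderiv_gatedOutput_setLayer {L d dout : ℕ} (B : Matrix (Fin dout) (Fin d) ℝ)
    (D : ℕ → Fin d → ℝ) (z : Fin d → ℝ) (w : WeightIndex L d → ℝ) (a b : WeightIndex L d)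
    (o : Fin dout) :
    fderiv ℝ (fun w => gatedOutput B D z (setLayer w b.1 (unitWeight b)) o) w (unitWeight a) =
      gatedOutput₂ B D z w a b o := by
  refine fderiv_apply_of_add_smul ?_ fun t => ?_
  · exact (((contDiff_gatedOutput B D z o (n := 1)).comp
      (contDiff_setLayer b.1 (unitWeight b))).differentiable (by simp)).differentiableAt
  · by_cases h : a.1 = b.1
    · rw [setLayer_add_smul_of_eq _ _ h, gatedOutput₂, if_pos h]
      simp
    · rw [setLayer_add_smul_of_ne _ _ h, gatedOutput₂, if_neg h,
        gatedOutput_add_smul_unitWeight, setLayer_comm _ _ _ h]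
      rfl

/-- The Hessian of a sum of squared residuals. -/
theorem fderiv_fderiv_sum_sq {ι κ : Type*} [Fintype ι] [Fintype κ] (c : ℝ) (y : κ → ℝ)
    (f g : κ → (ι → ℝ) → ℝ) (hf : ∀ q, ContDiff ℝ 2 (f q)) (e e' : ι → ℝ) (w : ι → ℝ)
    (hg : ∀ q w, fderiv ℝ (f q) w e' = g q w) :
    iteratedFDeriv ℝ 2 (fun w => c * ∑ q, (y q - f q w) ^ 2) w ![e, e'] =
      2 * c * ∑ q, (fderiv ℝ (f q) w e * g q w - (y q - f q w) * fderiv ℝ (g q) w e) := by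
  have hd : ∀ q, Differentiable ℝ (f q) := fun q => (hf q).differentiable (by simp)
  have hF : ContDiff ℝ 2 (fun w => c * ∑ q, (y q - f q w) ^ 2) :=
    contDiff_const.mul (ContDiff.sum fun q _ => (contDiff_const.sub (hf q)).pow 2)
  have hgd : ∀ q, Differentiable ℝ (g q) := fun q => by
    have h1 : Differentiable ℝ (fderiv ℝ (f q)) :=
      ((hf q).fderiv_right (m := 1) (by norm_num)).differentiable (by simp)
    have h2 : g q = fun w => fderiv ℝ (f q) w e' := by ext w; rw [hg]
    rw [h2]
    exact fun w => (h1 w).clm_apply (differentiableAt_const _)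
  have h1 : ∀ w, fderiv ℝ (fun w => c * ∑ q, (y q - f q w) ^ 2) w e' =
      c * ∑ q, (-2 * ((y q - f q w) * g q w)) := by
    intro w
    have h2 : HasFDerivAt (fun w => c * ∑ q, (y q - f q w) ^ 2) _ w :=
      (HasFDerivAt.fun_sum fun q _ =>
        ((hd q w).hasFDerivAt.const_sub (y q)).pow 2).const_mul c
    rw [h2.fderiv]
    simp only [smul_apply, sum_apply,
      neg_apply, smul_eq_mul, hg]
    congr 1
    refine Finset.sum_congr rfl fun q _ => ?_
    simp
    ring
  rw [iteratedFDeriv_two_apply]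
  simp only [Matrix.cons_val_zero, Matrix.cons_val_one]
  have h3 : Differentiable ℝ (fderiv ℝ (fun w => c * ∑ q, (y q - f q w) ^ 2)) :=
    (hF.fderiv_right (m := 1) (by norm_num)).differentiable (by simp)
  -- Evaluating the gradient at `e'` before differentiating again reduces everything to the
  -- directional derivatives `g q`.
  have h4 : fderiv ℝ (fderiv ℝ (fun w => c * ∑ q, (y q - f q w) ^ 2)) w e e' =
      fderiv ℝ (fun w => fderiv ℝ (fun w => c * ∑ q, (y q - f q w) ^ 2) w e') w e := by
    rw [fderiv_clm_apply (h3 w) (differentiableAt_const _)]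
    simp
  rw [h4]
  simp only [h1]
  have h5 : HasFDerivAt (fun w => c * ∑ q, (-2 * ((y q - f q w) * g q w))) _ w :=
    (HasFDerivAt.fun_sum fun q _ => ((((hd q w).hasFDerivAt.const_sub (y q)).mul
      (hgd q w).hasFDerivAt).const_mul (-2))).const_mul c
  rw [h5.fderiv]
  simp only [smul_apply, sum_apply,
    neg_apply, add_apply, smul_eq_mul]
  rw [mul_comm 2 c, mul_assoc, Finset.mul_sum _ _ (2 : ℝ)]
  congr 1
  refine Finset.sum_congr rfl fun q _ => ?_
  ring

/-! ### From the spectral radius to sums of squares -/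

/-- The spectrum is the real one, and a normalized real eigenvector turns the quadratic form into
its eigenvalue. -/
theorem spectralRadius_le_of_quadratic_form {ι : Type*} [Fintype ι] [DecidableEq ι]
    (M : Matrix ι ι ℝ) (c : ℝ)
    (h : ∀ v : ι → ℝ, ∑ a, v a ^ 2 = 1 → |∑ a, ∑ b, M a b * (v a * v b)| ≤ c) :
    spectralRadius ℝ M ≤ ENNReal.ofReal c := by
  refine iSup₂_le fun k hk => ?_
  rw [spectrum.mem_iff, Matrix.isUnit_iff_isUnit_det, isUnit_iff_ne_zero, not_not] at hk
  obtain ⟨v, hv, hMv⟩ := Matrix.exists_mulVec_eq_zero_iff.mpr hk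
  have hMv' : M *ᵥ v = k • v := by
    rw [Matrix.sub_mulVec, sub_eq_zero] at hMv
    rw [← hMv, Matrix.algebraMap_eq_diagonal]
    ext a
    simp [Matrix.mulVec_diagonal]
  have hV : 0 < ∑ a, v a ^ 2 := by
    obtain ⟨a, ha⟩ := Function.ne_iff.mp hv
    exact Finset.sum_pos' (fun _ _ => sq_nonneg _) ⟨a, Finset.mem_univ _, by
      have : v a ≠ 0 := ha
      positivity⟩
  set V := ∑ a, v a ^ 2 with hVdef
  have hs : Real.sqrt V ^ 2 = V := Real.sq_sqrt hV.le
  have hs0 : Real.sqrt V ≠ 0 := (Real.sqrt_pos.mpr hV).ne'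
  have h1 : ∑ a, ((Real.sqrt V)⁻¹ * v a) ^ 2 = 1 := by
    simp only [mul_pow, ← Finset.mul_sum, ← hVdef]
    rw [inv_pow, hs, inv_mul_cancel₀ hV.ne']
  have h2 := h _ h1
  have h3 : ∑ a, ∑ b, M a b * ((Real.sqrt V)⁻¹ * v a * ((Real.sqrt V)⁻¹ * v b)) = k := by
    have h4 : ∀ a, ∑ b, M a b * v b = k * v a := fun a => congrFun hMv' a
    calc ∑ a, ∑ b, M a b * ((Real.sqrt V)⁻¹ * v a * ((Real.sqrt V)⁻¹ * v b))
        = ∑ a, ((Real.sqrt V)⁻¹ ^ 2 * v a) * ∑ b, M a b * v b := by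
          simp only [Finset.mul_sum]
          refine Finset.sum_congr rfl fun a _ => Finset.sum_congr rfl fun b _ => by ring
      _ = (Real.sqrt V)⁻¹ ^ 2 * k * ∑ a, v a ^ 2 := by
          simp only [h4, Finset.mul_sum]
          refine Finset.sum_congr rfl fun a _ => by ring
      _ = k := by rw [← hVdef, inv_pow, hs]; field_simp
  rw [h3] at h2
  rw [← ENNReal.ofReal_coe_nnreal, coe_nnnorm, Real.norm_eq_abs]
  exact ENNReal.ofReal_le_ofReal h2

/-- Operator norms are traded for Frobenius norms, whose expectations are computable. The
Gauss-Newton part is Cauchy-Schwarz. For the residual part, `√α` goes to `r q * (v a * v b)` and its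
inverse to `h q a b`, and the sum of `v a ^ 2 * v b ^ 2` is `1`. -/
theorem abs_gaussNewton_quadratic_form_le {ι κ : Type*} [Fintype ι] [Fintype κ]
    (J : κ → ι → ℝ) (r : κ → ℝ) (h : κ → ι → ι → ℝ) {α : ℝ} (hα : 0 < α) (v : ι → ℝ)
    (hv : ∑ a, v a ^ 2 = 1) :
    |∑ a, ∑ b, (∑ q, (J q a * J q b - r q * h q a b)) * (v a * v b)| ≤
      ∑ q, (∑ a, J q a ^ 2 + (α * r q ^ 2 + α⁻¹ * ∑ a, ∑ b, h q a b ^ 2) / 2) := by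
  have h1 : ∑ a, ∑ b, (∑ q, (J q a * J q b - r q * h q a b)) * (v a * v b) =
      ∑ q, ((∑ a, v a * J q a) ^ 2 - ∑ a, ∑ b, r q * h q a b * (v a * v b)) := by
    simp only [Finset.sum_mul, sq, Finset.sum_sub_distrib, sub_mul, Finset.mul_sum]
    congr 1
    · rw [Finset.sum_comm' (t' := Finset.univ) (s' := fun _ => Finset.univ) (by simp)]
      simp only [Finset.sum_comm (s := Finset.univ (α := ι)) (t := Finset.univ (α := κ))]
      refine Finset.sum_congr rfl fun q _ => Finset.sum_congr rfl fun a _ =>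
        Finset.sum_congr rfl fun b _ => by ring
    · simp only [Finset.sum_comm (s := Finset.univ (α := ι)) (t := Finset.univ (α := κ))]
  rw [h1]
  refine (Finset.abs_sum_le_sum_abs _ _).trans (Finset.sum_le_sum fun q _ => ?_)
  refine (abs_sub _ _).trans (add_le_add ?_ ?_)
  · rw [abs_of_nonneg (sq_nonneg _)]
    calc (∑ a, v a * J q a) ^ 2 ≤ (∑ a, v a ^ 2) * ∑ a, J q a ^ 2 :=
          Finset.sum_mul_sq_le_sq_mul_sq _ _ _
      _ = _ := by rw [hv, one_mul]
  · have h2 : ∀ a b, |r q * h q a b * (v a * v b)| ≤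
        (α * r q ^ 2 * (v a ^ 2 * v b ^ 2) + α⁻¹ * h q a b ^ 2) / 2 := by
      intro a b
      have hs : Real.sqrt α ^ 2 = α := Real.sq_sqrt hα.le
      have hs0 : Real.sqrt α ≠ 0 := (Real.sqrt_pos.mpr hα).ne'
      have h3 := two_mul_le_add_sq |Real.sqrt α * (r q * (v a * v b))|
        |(Real.sqrt α)⁻¹ * h q a b|
      rw [mul_assoc, ← abs_mul, sq_abs, sq_abs, mul_pow (Real.sqrt α), mul_pow (Real.sqrt α)⁻¹, inv_pow,
        hs] at h3
      have h4 : Real.sqrt α * (r q * (v a * v b)) * ((Real.sqrt α)⁻¹ * h q a b) =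
          r q * h q a b * (v a * v b) := by field_simp
      rw [h4] at h3
      have h5 : α * (r q * (v a * v b)) ^ 2 = α * r q ^ 2 * (v a ^ 2 * v b ^ 2) := by ring
      linarith
    calc |∑ a, ∑ b, r q * h q a b * (v a * v b)|
        ≤ ∑ a, ∑ b, (α * r q ^ 2 * (v a ^ 2 * v b ^ 2) + α⁻¹ * h q a b ^ 2) / 2 :=
          (Finset.abs_sum_le_sum_abs _ _).trans (Finset.sum_le_sum fun a _ =>
            (Finset.abs_sum_le_sum_abs _ _).trans (Finset.sum_le_sum fun b _ => h2 a b))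
      _ = _ := by
          simp only [← Finset.sum_div, Finset.sum_add_distrib, ← Finset.mul_sum, hv, mul_one]

/-- The activation gates at the weights `w`. -/
noncomputable def gates (act : Activation) {L d : ℕ} (w : WeightIndex L d → ℝ) (z : Fin d → ℝ) (k : ℕ) :
    Fin d → ℝ :=
  fun j => act.gate (preact act w z k j)

/-- The gated activations in layer `k` for the weights `w'`, with the gates of the weights `w`. -/
noncomputable def gatedState (act : Activation) {L d : ℕ} (w : WeightIndex L d → ℝ) (z : Fin d → ℝ)
    (w' : WeightIndex L d → ℝ) (k : ℕ) : Fin d → ℝ :=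
  fun j => gates act w z k j * gatedForward (gates act w z) w' z k j

theorem gatedOutput_gates (act : Activation) {L d dout : ℕ} (B : Matrix (Fin dout) (Fin d) ℝ)
    (w w' : WeightIndex L d → ℝ) (z : Fin d → ℝ) :
    gatedOutput B (gates act w z) z w' = B *ᵥ gatedState act w z w' L := rfl

theorem sum_mulVec_sq_le {m n : Type*} [Fintype m] [Fintype n] (B : Matrix m n ℝ) (v : n → ℝ) :
    ∑ o, (B *ᵥ v) o ^ 2 ≤ (∑ o, ∑ j, B o j ^ 2) * ∑ j, v j ^ 2 := by
  rw [Finset.sum_mul]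
  exact Finset.sum_le_sum fun o _ => Finset.sum_mul_sq_le_sq_mul_sq _ _ _

/-- Squared norm of the activations in the last hidden layer, with the gates at `w`. -/
noncomputable def lastStateSq (act : Activation) {L d : ℕ} (w : WeightIndex L d → ℝ) (z : Fin d → ℝ)
    (w' : WeightIndex L d → ℝ) : ℝ :=
  ∑ j, gatedState act w z w' L j ^ 2

/-- Weighted sum of the squared norms of the last hidden layer and of its first two derivatives in
the weights. -/
noncomputable def derivativeEnergy (act : Activation) {L d : ℕ} (α : ℝ) (w : WeightIndex L d → ℝ)
    (z : Fin d → ℝ) : ℝ :=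
  ∑ a, lastStateSq act w z (setLayer w a.1 (unitWeight a)) + α * lastStateSq act w z w +
    α⁻¹ * ∑ a, ∑ b, if a.1 = b.1 then 0 else
      lastStateSq act w z (setLayer (setLayer w a.1 (unitWeight a)) b.1 (unitWeight b))

theorem networkHessian_apply (act : Activation) {L d din dout n : ℕ}
    (A : Matrix (Fin d) (Fin din) ℝ) (B : Matrix (Fin dout) (Fin d) ℝ)
    (x : Fin n → Fin din → ℝ) (y : Fin n → Fin dout → ℝ) (w : WeightIndex L d → ℝ)
    (a b : WeightIndex L d) :
    networkHessian act A B x y w a b = (n : ℝ)⁻¹ * ∑ q : Fin n × Fin dout,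
      (gatedOutput B (gates act w (A *ᵥ x q.1)) (A *ᵥ x q.1)
          (setLayer w a.1 (unitWeight a)) q.2 *
        gatedOutput B (gates act w (A *ᵥ x q.1)) (A *ᵥ x q.1)
          (setLayer w b.1 (unitWeight b)) q.2 -
        (y q.1 q.2 - gatedOutput B (gates act w (A *ᵥ x q.1)) (A *ᵥ x q.1) w q.2) *
        gatedOutput₂ B (gates act w (A *ᵥ x q.1)) (A *ᵥ x q.1) w a b q.2) := by
  have h1 : gatedLoss act A B x y w = fun w' => 1 / (2 * (n : ℝ)) * ∑ q : Fin n × Fin dout,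
      (y q.1 q.2 - gatedOutput B (gates act w (A *ᵥ x q.1)) (A *ᵥ x q.1) w' q.2) ^ 2 := by
    ext w'
    rw [Fintype.sum_prod_type]
    rfl
  simp only [networkHessian, hessianMatrix, Matrix.of_apply, h1]
  have h2 := fderiv_fderiv_sum_sq (1 / (2 * (n : ℝ))) (fun q : Fin n × Fin dout => y q.1 q.2)
    (fun q w' => gatedOutput B (gates act w (A *ᵥ x q.1)) (A *ᵥ x q.1) w' q.2)
    (fun q w' => gatedOutput B (gates act w (A *ᵥ x q.1)) (A *ᵥ x q.1)
      (setLayer w' b.1 (unitWeight b)) q.2)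
    (fun q => contDiff_gatedOutput _ _ _ _) (unitWeight a) (unitWeight b) w
    (fun q w' => fderiv_gatedOutput _ _ _ _ _ _)
  simp only [fderiv_gatedOutput, fderiv_gatedOutput_setLayer] at h2
  refine h2.trans ?_
  congr 1
  rw [one_div, mul_inv]
  ring

/-- The targets are split off by `(y - f)² ≤ 2 y² + 2 f²`, the `2` cancelling the `1/2` of AM-GM.
The matrix `B` leaves every term through its Frobenius norm, so that only hidden states remain. -/
theorem spectralRadius_networkHessian_le (act : Activation) {L d din dout n : ℕ}
    (A : Matrix (Fin d) (Fin din) ℝ) (B : Matrix (Fin dout) (Fin d) ℝ)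
    (x : Fin n → Fin din → ℝ) (y : Fin n → Fin dout → ℝ) (w : WeightIndex L d → ℝ)
    {α : ℝ} (hα : 0 < α) :
    spectralRadius ℝ (networkHessian act A B x y w) ≤
      ENNReal.ofReal ((n : ℝ)⁻¹ * ∑ i, (α * ∑ o, y i o ^ 2 +
        (∑ o, ∑ j, B o j ^ 2) * derivativeEnergy act α w (A *ᵥ x i))) := by
  refine spectralRadius_le_of_quadratic_form _ _ fun v hv => ?_
  simp only [networkHessian_apply, mul_assoc, ← Finset.mul_sum]
  rw [abs_mul, abs_of_nonneg (by positivity)]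
  refine mul_le_mul_of_nonneg_left ?_ (by positivity)
  refine (abs_gaussNewton_quadratic_form_le _ _ _ hα v hv).trans ?_
  rw [Fintype.sum_prod_type]
  refine Finset.sum_le_sum fun i _ => ?_
  set z := A *ᵥ x i
  simp only [gatedOutput₂, gatedOutput_gates]
  set b := ∑ o, ∑ j, B o j ^ 2
  have hb : 0 ≤ b := by positivity
  have key : ∀ w', ∑ o, (B *ᵥ gatedState act w z w' L) o ^ 2 ≤ b * lastStateSq act w z w' :=
    fun w' => sum_mulVec_sq_le B _
  have h1 : ∑ o, ∑ a : WeightIndex L d,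
      (B *ᵥ gatedState act w z (setLayer w a.1 (unitWeight a)) L) o ^ 2 ≤
      b * ∑ a, lastStateSq act w z (setLayer w a.1 (unitWeight a)) := by
    rw [Finset.sum_comm, Finset.mul_sum]
    exact Finset.sum_le_sum fun a _ => key _
  have h2 : ∑ o, α * (y i o - (B *ᵥ gatedState act w z w L) o) ^ 2 ≤
      2 * (α * ∑ o, y i o ^ 2) + 2 * (b * (α * lastStateSq act w z w)) := by
    have h3 : ∑ o, α * (y i o - (B *ᵥ gatedState act w z w L) o) ^ 2 ≤
        ∑ o, (2 * (α * y i o ^ 2) + 2 * (α * (B *ᵥ gatedState act w z w L) o ^ 2)) := by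
      refine Finset.sum_le_sum fun o _ => ?_
      have := mul_nonneg hα.le (sq_nonneg (y i o + (B *ᵥ gatedState act w z w L) o))
      nlinarith
    simp only [Finset.sum_add_distrib, ← Finset.mul_sum] at h3 ⊢
    have h4 := mul_le_mul_of_nonneg_left (key w) hα.le
    linarith
  have h5 : ∑ o, ∑ a : WeightIndex L d, ∑ c : WeightIndex L d, (if a.1 = c.1 then (0 : Fin dout → ℝ)
      else B *ᵥ gatedState act w z
        (setLayer (setLayer w a.1 (unitWeight a)) c.1 (unitWeight c)) L) o ^ 2 ≤
      b * ∑ a : WeightIndex L d, ∑ c : WeightIndex L d, if a.1 = c.1 then 0 else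
        lastStateSq act w z (setLayer (setLayer w a.1 (unitWeight a)) c.1 (unitWeight c)) := by
    rw [Finset.sum_comm, Finset.mul_sum]
    refine Finset.sum_le_sum fun a _ => ?_
    rw [Finset.sum_comm, Finset.mul_sum]
    refine Finset.sum_le_sum fun c _ => ?_
    split_ifs
    · simp
    · exact key _
  have h5' : 0 ≤ ∑ a : WeightIndex L d, ∑ c : WeightIndex L d, if a.1 = c.1 then 0 else
        lastStateSq act w z (setLayer (setLayer w a.1 (unitWeight a)) c.1 (unitWeight c)) :=
    Finset.sum_nonneg fun a _ => Finset.sum_nonneg fun c _ => by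
      split_ifs
      · exact le_rfl
      · exact Finset.sum_nonneg fun _ _ => sq_nonneg _
  have h6 := mul_le_mul_of_nonneg_left h5 (inv_pos.mpr hα).le
  have h7 := mul_nonneg (inv_pos.mpr hα).le (mul_nonneg hb h5')
  rw [Finset.sum_add_distrib, ← Finset.sum_div, Finset.sum_add_distrib, ← Finset.mul_sum _ _ α⁻¹,
    derivativeEnergy]
  linarith

/-! ### Second moments of gated symmetric linear forms -/

theorem measurePreserving_neg_pi {ι : Type*} [Fintype ι] {P : Measure ℝ}
    [IsProbabilityMeasure P] (hP : P.map (fun t => -t) = P) :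
    MeasurePreserving (fun (y : ι → ℝ) a => -y a) (Measure.pi fun _ => P)
      (Measure.pi fun _ => P) :=
  measurePreserving_pi (fun _ => P) (fun _ => P) (f := fun _ t => -t)
    fun _ => ⟨measurable_neg, hP⟩

/-- By symmetry the linear form has mean zero, so its second moment is its variance, and variances
of independent summands add. -/
theorem lintegral_sq_sum_mul {ι : Type*} [Fintype ι] {P : Measure ℝ} {σ : ℝ}
    [IsProbabilityMeasure P] (hP : IsInitLaw P σ) (v : ι → ℝ) :
    ∫⁻ y : ι → ℝ, ENNReal.ofReal ((∑ a, y a * v a) ^ 2) ∂Measure.pi (fun _ => P) =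
      ENNReal.ofReal (σ ^ 2 * ∑ a, v a ^ 2) := by
  -- The fourth moment serves only to provide square integrability.
  have hid : MemLp id 2 P := hP.fourth_moment.mono_exponent (by norm_num)
  have hmem : ∀ a, MemLp (fun t : ℝ => t * v a) 2 P := fun a => by
    simpa [mul_comm] using hid.const_mul (v a)
  have hvar := variance_sum_pi (μ := fun _ : ι => P) (X := fun a t => t * v a) hmem
  have hsum : (∑ a, fun y : ι → ℝ => y a * v a) = fun y => ∑ a, y a * v a := by
    ext y
    simp
  have h1 : ∀ a, Var[fun t : ℝ => t * v a; P] = σ ^ 2 * v a ^ 2 := fun a => by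
    rw [variance_mul_const, mul_comm, ← hP.variance_eq]
    exact mul_comm _ _
  simp only [hsum, h1, ← Finset.mul_sum] at hvar
  have hmem' : MemLp (fun y : ι → ℝ => ∑ a, y a * v a) 2 (Measure.pi fun _ => P) :=
    memLp_finsetSum _ fun a _ => (hmem a).comp_measurePreserving (measurePreserving_eval _ a)
  have hmean : ∫ y : ι → ℝ, ∑ a, y a * v a ∂Measure.pi (fun _ => P) = 0 := by
    have h2 := (measurePreserving_neg_pi (ι := ι) hP.symmetric).integral_comp'
      (f := MeasurableEquiv.neg (ι → ℝ)) (fun y => ∑ a, y a * v a)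
    have h3 : ∀ y : ι → ℝ, ∑ a, (MeasurableEquiv.neg (ι → ℝ)) y a * v a = -∑ a, y a * v a := by
      intro y
      simp
    simp only [h3, integral_neg] at h2
    linarith
  rw [← hvar, ofReal_variance hmem', evariance_eq_lintegral_ofReal, hmean]
  simp

theorem Activation.gate_nonneg (act : Activation) (t : ℝ) : 0 ≤ act.gate t := by
  cases act
  · simp [Activation.gate]
  · simp only [Activation.gate]
    split_ifs <;> norm_num

theorem Activation.gate_le_one (act : Activation) (t : ℝ) : act.gate t ≤ 1 := by
  cases act
  · simp [Activation.gate]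
  · simp only [Activation.gate]
    split_ifs <;> norm_num

theorem Activation.measurable_gate (act : Activation) : Measurable act.gate := by
  cases act
  · exact measurable_const
  · exact Measurable.ite measurableSet_Ioi measurable_const measurable_const

theorem Activation.measurable_fn (act : Activation) : Measurable act.fn := by
  cases act
  · exact measurable_id
  · exact measurable_id.max measurable_const

theorem Activation.p_nonneg (act : Activation) : 0 ≤ act.p := by
  cases act <;> norm_num [Activation.p]

/-- A gate keeps at most the fraction `p` of the second moment of a symmetric linear form. -/
theorem lintegral_gate_mul_sq_le {ι : Type*} [Fintype ι] {P : Measure ℝ} {σ : ℝ}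
    [IsProbabilityMeasure P] (hP : IsInitLaw P σ) (act : Activation) (u v : ι → ℝ) :
    ∫⁻ y : ι → ℝ, ENNReal.ofReal (act.gate (∑ a, y a * u a) * (∑ a, y a * v a) ^ 2)
      ∂Measure.pi (fun _ => P) ≤ ENNReal.ofReal (act.p * σ ^ 2 * ∑ a, v a ^ 2) := by
  cases act with
  | linear =>
    simp only [Activation.gate, Activation.p, one_mul]
    exact (lintegral_sq_sum_mul hP v).le
  | relu =>
    set f : (ι → ℝ) → ℝ≥0∞ := fun y =>
      ENNReal.ofReal (Activation.relu.gate (∑ a, y a * u a) * (∑ a, y a * v a) ^ 2) with hf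
    have hfm : Measurable f := by
      refine ENNReal.measurable_ofReal.comp (Measurable.mul ?_ (by fun_prop))
      exact (Activation.measurable_gate _).comp (by fun_prop)
    have hneg : ∫⁻ y, f (fun a => -y a) ∂Measure.pi (fun _ => P) =
        ∫⁻ y, f y ∂Measure.pi (fun _ => P) :=
      (measurePreserving_neg_pi (ι := ι) hP.symmetric).lintegral_comp hfm
    -- The preactivations at `y` and `-y` are opposite, so at most one of the two gates is open,
    -- while the square is even. Both gates are closed when the preactivation is `0`, hence an
    -- inequality.
    have hle : ∀ y, f y + f (fun a => -y a) ≤ ENNReal.ofReal ((∑ a, y a * v a) ^ 2) := by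
      intro y
      simp only [hf, neg_mul, Finset.sum_neg_distrib, neg_sq]
      rw [← ENNReal.ofReal_add
        (mul_nonneg (Activation.gate_nonneg _ _) (sq_nonneg _))
        (mul_nonneg (Activation.gate_nonneg _ _) (sq_nonneg _)), ← add_mul]
      refine ENNReal.ofReal_le_ofReal (mul_le_of_le_one_left (sq_nonneg _) ?_)
      simp only [Activation.gate]
      split_ifs <;> linarith
    have h1 : 2 * ∫⁻ y, f y ∂Measure.pi (fun _ => P) ≤
        ENNReal.ofReal (σ ^ 2 * ∑ a, v a ^ 2) := by
      rw [← lintegral_sq_sum_mul hP v, two_mul]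
      nth_rewrite 2 [← hneg]
      rw [← lintegral_add_left hfm]
      exact lintegral_mono hle
    have h2 : ENNReal.ofReal (Activation.relu.p * σ ^ 2 * ∑ a, v a ^ 2) =
        2⁻¹ * ENNReal.ofReal (σ ^ 2 * ∑ a, v a ^ 2) := by
      rw [mul_assoc, ENNReal.ofReal_mul (by norm_num [Activation.p])]
      congr 1
      rw [Activation.p, one_div, ENNReal.ofReal_inv_of_pos (by norm_num)]
      norm_num
    rw [h2]
    calc ∫⁻ y, f y ∂Measure.pi (fun _ => P)
        = 2⁻¹ * (2 * ∫⁻ y, f y ∂Measure.pi (fun _ => P)) := by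
          rw [← mul_assoc, ENNReal.inv_mul_cancel (by norm_num) (by norm_num), one_mul]
      _ ≤ _ := by gcongr

/-- The same bound when the coefficients of the linear forms depend on other coordinates. -/
theorem lintegral_gate_mul_sq_le_of_indep {ι : Type*} [Fintype ι] [DecidableEq ι]
    {P : Measure ℝ} {σ : ℝ} [IsProbabilityMeasure P] (hP : IsInitLaw P σ) (act : Activation)
    (s : Finset ι) (u v : ι → (ι → ℝ) → ℝ) (hu : ∀ a, Measurable (u a))
    (hv : ∀ a, Measurable (v a))
    (hus : ∀ a w w', (∀ b ∉ s, w b = w' b) → u a w = u a w')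
    (hvs : ∀ a w w', (∀ b ∉ s, w b = w' b) → v a w = v a w') :
    ∫⁻ w : ι → ℝ, ENNReal.ofReal (act.gate (∑ a ∈ s, w a * u a w) *
        (∑ a ∈ s, w a * v a w) ^ 2) ∂Measure.pi (fun _ => P) ≤
      ∫⁻ w : ι → ℝ, ENNReal.ofReal (act.p * σ ^ 2 * ∑ a ∈ s, v a w ^ 2)
        ∂Measure.pi (fun _ => P) := by
  -- The coordinates in `s` are integrated first; with the others frozen, the coefficients are
  -- constants.
  refine lintegral_le_of_lmarginal_le s ?_ ?_ ?_
  · refine ENNReal.measurable_ofReal.comp (Measurable.mul ?_ (by fun_prop))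
    exact act.measurable_gate.comp (by fun_prop)
  · fun_prop
  · intro w
    have hmem : ∀ (y : s → ℝ), ∀ b ∉ s, Function.updateFinset w s y b = w b := fun y b hb => by
      simp [Function.updateFinset, hb]
    have hin : ∀ (y : s → ℝ) (a : s), Function.updateFinset w s y a = y a := fun y a => by
      simp [Function.updateFinset]
    simp only [lmarginal, fun a y => hus a _ _ (hmem y), fun a y => hvs a _ _ (hmem y)]
    rw [lintegral_const, measure_univ, mul_one]
    simp only [← Finset.sum_coe_sort s, hin]
    exact lintegral_gate_mul_sq_le hP act (fun a : s => u a w) (fun a : s => v a w)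

/-! ### Propagation of second moments through the layers -/

theorem preact_congr (act : Activation) {L d : ℕ} {w w' : WeightIndex L d → ℝ} (z : Fin d → ℝ)
    (k : ℕ) (hw : ∀ a : WeightIndex L d, a.1.val < k → w a = w' a) :
    preact act w z k = preact act w' z k := by
  induction k with
  | zero => rfl
  | succ k ih =>
    have h1 := ih fun a ha => hw a (by omega)
    have h2 : weightMatrix w k = weightMatrix w' k := by
      ext i j
      simp only [weightMatrix, Matrix.of_apply]
      split_ifs with h
      · exact hw _ (by simp)
      · rfl
    simp only [preact, h1, h2]

theorem measurable_weightMatrix_apply {L d : ℕ} (k : ℕ) (i j : Fin d) :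
    Measurable fun w : WeightIndex L d → ℝ => weightMatrix w k i j := by
  simp only [weightMatrix, Matrix.of_apply]
  split_ifs
  · exact measurable_pi_apply _
  · exact measurable_const

theorem measurable_preact (act : Activation) {L d : ℕ} (k : ℕ) (i : Fin d) :
    Measurable fun q : (WeightIndex L d → ℝ) × (Fin d → ℝ) => preact act q.1 q.2 k i := by
  induction k generalizing i with
  | zero => exact (measurable_pi_apply i).comp measurable_snd
  | succ k ih =>
    simp only [preact, Matrix.mulVec, dotProduct]
    exact Finset.measurable_fun_sum _ fun j _ =>
      ((measurable_weightMatrix_apply k i j).comp measurable_fst).mul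
        (act.measurable_fn.comp (ih j))

theorem measurable_gates (act : Activation) {L d : ℕ} (k : ℕ) (i : Fin d) :
    Measurable fun q : (WeightIndex L d → ℝ) × (Fin d → ℝ) => gates act q.1 q.2 k i :=
  act.measurable_gate.comp (measurable_preact act k i)

theorem measurable_gatedForward_gates (act : Activation) {L d : ℕ} (k : ℕ) (i : Fin d) :
    Measurable fun q : ((WeightIndex L d → ℝ) × (Fin d → ℝ)) × (WeightIndex L d → ℝ) =>
      gatedForward (gates act q.1.1 q.1.2) q.2 q.1.2 k i := by
  induction k generalizing i with
  | zero => exact (measurable_pi_apply i).comp (measurable_snd.comp measurable_fst)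
  | succ k ih =>
    simp only [gatedForward, Matrix.mulVec, dotProduct]
    exact Finset.measurable_fun_sum _ fun j _ =>
      ((measurable_weightMatrix_apply k i j).comp measurable_snd).mul
        (((measurable_gates act k j).comp measurable_fst).mul (ih j))

theorem measurable_gatedState (act : Activation) {L d : ℕ} (k : ℕ) (i : Fin d) :
    Measurable fun q : ((WeightIndex L d → ℝ) × (Fin d → ℝ)) × (WeightIndex L d → ℝ) =>
      gatedState act q.1.1 q.1.2 q.2 k i :=
  ((measurable_gates act k i).comp measurable_fst).mul (measurable_gatedForward_gates act k i)

theorem measurable_setLayer {L d : ℕ} (ℓ : Fin L) (u : WeightIndex L d → ℝ) :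
    Measurable fun w => setLayer w ℓ u :=
  (contDiff_setLayer ℓ u (n := 0)).continuous.measurable

/-- State and gates of layer `k` involve only weight matrices with index below `k`, so they are
unaffected by the matrix with index `k` that acts next. This is the independence needed for
`lintegral_layer_le`. -/
theorem gatedState_congr (act : Activation) {L d : ℕ} {w₁ w₂ w₁' w₂' : WeightIndex L d → ℝ}
    (z : Fin d → ℝ) (k : ℕ) (h : ∀ a : WeightIndex L d, a.1.val < k → w₁ a = w₂ a)
    (h' : ∀ a : WeightIndex L d, a.1.val < k → w₁' a = w₂' a) :
    gatedState act w₁ z w₁' k = gatedState act w₂ z w₂' k := by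
  have hg : ∀ j ≤ k, gates act w₁ z j = gates act w₂ z j := fun j hj => by
    funext i
    simp only [gates, preact_congr act z j fun a ha => h a (by omega)]
  funext i
  simp only [gatedState, hg k le_rfl,
    gatedForward_congr z k (fun j hj => hg j hj.le) h']

theorem gatedState_succ (act : Activation) {L d : ℕ} (w w' : WeightIndex L d → ℝ)
    (z : Fin d → ℝ) (k : ℕ) (i : Fin d) :
    gatedState act w z w' (k + 1) i =
      act.gate (preact act w z (k + 1) i) * (weightMatrix w' k *ᵥ gatedState act w z w' k) i :=
  rfl

theorem Activation.gate_sq (act : Activation) (t : ℝ) : act.gate t ^ 2 = act.gate t := by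
  cases act
  · simp [Activation.gate]
  · simp only [Activation.gate]
    split_ifs <;> norm_num

/-- One random layer multiplies the expected squared norm by at most `p d σ²`. -/
theorem lintegral_layer_le {L d : ℕ} {P : Measure ℝ} {σ : ℝ} [IsProbabilityMeasure P]
    (hP : IsInitLaw P σ) (act : Activation) (z : Fin d → ℝ) {k : ℕ} (hk : k < L)
    (v : (WeightIndex L d → ℝ) → Fin d → ℝ) (hv : ∀ j, Measurable fun w => v w j)
    (hdep : ∀ w w' : WeightIndex L d → ℝ, (∀ a : WeightIndex L d, a.1.val < k → w a = w' a) →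
      v w = v w') :
    ∫⁻ w, ENNReal.ofReal (∑ i, (act.gate (preact act w z (k + 1) i) *
        (weightMatrix w k *ᵥ v w) i) ^ 2) ∂Measure.pi (fun _ => P) ≤
      ENNReal.ofReal (act.p * d * σ ^ 2) *
        ∫⁻ w, ENNReal.ofReal (∑ j, v w j ^ 2) ∂Measure.pi (fun _ => P) := by
  have hm : ∀ i, Measurable fun w : WeightIndex L d → ℝ =>
      ENNReal.ofReal ((act.gate (preact act w z (k + 1) i) * (weightMatrix w k *ᵥ v w) i) ^ 2) := by
    intro i
    have h1 : Measurable fun w : WeightIndex L d → ℝ => act.gate (preact act w z (k + 1) i) :=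
      act.measurable_gate.comp ((measurable_preact act (k + 1) i).comp
        (measurable_id.prodMk measurable_const))
    have h2 : Measurable fun w : WeightIndex L d → ℝ => (weightMatrix w k *ᵥ v w) i := by
      simp only [Matrix.mulVec, dotProduct]
      exact Finset.measurable_fun_sum _ fun j _ => (measurable_weightMatrix_apply k i j).mul (hv j)
    exact ENNReal.measurable_ofReal.comp ((h1.mul h2).pow_const 2)
  simp only [ENNReal.ofReal_sum_of_nonneg fun i _ => sq_nonneg _]
  rw [lintegral_finsetSum _ fun i _ => hm i]
  have key : ∀ i : Fin d, ∫⁻ w : WeightIndex L d → ℝ,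
      ENNReal.ofReal ((act.gate (preact act w z (k + 1) i) * (weightMatrix w k *ᵥ v w) i) ^ 2)
        ∂Measure.pi (fun _ => P) ≤
      ∫⁻ w, ENNReal.ofReal (act.p * σ ^ 2 * ∑ j, v w j ^ 2) ∂Measure.pi (fun _ => P) := by
    intro i
    -- The weights of row `i`. The gate and the linear form of neuron `i` use this row and otherwise
    -- only earlier layers. Rows are treated separately, and the `d` of them give the factor `d`.
    let e : Fin d ↪ WeightIndex L d := ⟨fun j => (⟨k, hk⟩, i, j), fun j j' h => by simpa using h⟩
    have hs : ∀ w w' : WeightIndex L d → ℝ, (∀ b ∉ Finset.univ.map e, w b = w' b) →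
        ∀ a : WeightIndex L d, a.1.val < k → w a = w' a := by
      intro w w' h a ha
      refine h a fun hmem => ?_
      obtain ⟨j, -, rfl⟩ := Finset.mem_map.mp hmem
      exact lt_irrefl _ ha
    have h1 := lintegral_gate_mul_sq_le_of_indep hP act (Finset.univ.map e)
      (fun a w => act.fn (preact act w z k a.2.2)) (fun a w => v w a.2.2)
      (fun a => act.measurable_fn.comp ((measurable_preact act k a.2.2).comp
        (measurable_id.prodMk measurable_const)))
      (fun a => hv a.2.2)
      (fun a w w' h => by simp only [preact_congr act z k (hs w w' h)])
      (fun a w w' h => by simp only [hdep w w' (hs w w' h)])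
    simp only [Finset.sum_map] at h1
    refine le_of_eq_of_le (lintegral_congr fun w => ?_) h1
    rw [mul_pow, act.gate_sq]
    simp only [preact, Matrix.mulVec, dotProduct, weightMatrix, Matrix.of_apply, hk, dif_pos]
    rfl
  refine (Finset.sum_le_sum fun i _ => key i).trans ?_
  rw [Finset.sum_const, Finset.card_univ, Fintype.card_fin, nsmul_eq_mul]
  simp only [← ENNReal.ofReal_sum_of_nonneg fun i _ => sq_nonneg _]
  have h2 : ∀ w, ENNReal.ofReal (act.p * σ ^ 2 * ∑ j, v w j ^ 2) =
      ENNReal.ofReal (act.p * σ ^ 2) * ENNReal.ofReal (∑ j, v w j ^ 2) := fun w =>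
    ENNReal.ofReal_mul (mul_nonneg act.p_nonneg (sq_nonneg σ))
  simp only [h2]
  rw [lintegral_const_mul _ (by fun_prop), ← mul_assoc]
  refine mul_le_mul_left ?_ _
  rw [← ENNReal.ofReal_natCast, ← ENNReal.ofReal_mul (by positivity)]
  exact ENNReal.ofReal_le_ofReal (le_of_eq (by ring))

/-- Expected squared norm of the gated activations in layer `k`, for the modification `τ` of the
weights. -/
noncomputable def stateEnergy (act : Activation) {L d : ℕ} (P : Measure ℝ) (z : Fin d → ℝ)
    (τ : (WeightIndex L d → ℝ) → WeightIndex L d → ℝ) (k : ℕ) : ℝ≥0∞ :=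
  ∫⁻ w, ENNReal.ofReal (∑ j, gatedState act w z (τ w) k j ^ 2) ∂Measure.pi (fun _ => P)

/-- A measurable modification of the weights that acts layer by layer. -/
structure IsCausal {L d : ℕ} (τ : (WeightIndex L d → ℝ) → WeightIndex L d → ℝ) : Prop where
  measurable : Measurable τ
  congr : ∀ w w' k, (∀ a : WeightIndex L d, a.1.val < k → w a = w' a) →
    ∀ a : WeightIndex L d, a.1.val < k → τ w a = τ w' a

theorem isCausal_id {L d : ℕ} :
    IsCausal (id : (WeightIndex L d → ℝ) → WeightIndex L d → ℝ) :=
  ⟨measurable_id, fun _ _ _ h => h⟩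

theorem IsCausal.setLayer {L d : ℕ} {τ : (WeightIndex L d → ℝ) → WeightIndex L d → ℝ}
    (h : IsCausal τ) (ℓ : Fin L) (u : WeightIndex L d → ℝ) :
    IsCausal fun w => setLayer (τ w) ℓ u :=
  ⟨(measurable_setLayer ℓ u).comp h.measurable, fun w w' k hw a ha => by
    simp only [_root_.setLayer]
    split_ifs
    · rfl
    · exact h.congr w w' k hw a ha⟩

theorem IsCausal.measurable_gatedState {L d : ℕ}
    {τ : (WeightIndex L d → ℝ) → WeightIndex L d → ℝ} (h : IsCausal τ) (act : Activation)
    (z : Fin d → ℝ) (k : ℕ) (j : Fin d) : Measurable fun w => gatedState act w z (τ w) k j :=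
  (_root_.measurable_gatedState act k j).comp
    ((measurable_id.prodMk measurable_const).prodMk h.measurable)

/-- The modified forward pass keeps the gates of the original weights, so wherever `τ` leaves the
layers alone the one-layer bound can be iterated. -/
theorem stateEnergy_le_pow_mul {L d : ℕ} {P : Measure ℝ} {σ : ℝ} [IsProbabilityMeasure P]
    (hP : IsInitLaw P σ) (act : Activation) (z : Fin d → ℝ)
    {τ : (WeightIndex L d → ℝ) → WeightIndex L d → ℝ} (hτ : IsCausal τ) {k k' : ℕ}
    (hkk' : k ≤ k') (hk' : k' ≤ L)
    (h : ∀ j, k ≤ j → j < k' → ∀ w, weightMatrix (τ w) j = weightMatrix w j) :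
    stateEnergy act P z τ k' ≤
      ENNReal.ofReal (act.p * d * σ ^ 2) ^ (k' - k) * stateEnergy act P z τ k := by
  induction k', hkk' using Nat.le_induction with
  | base => simp
  | succ m hm ih =>
    have h1 := ih (by omega) fun j hj hj' => h j hj (by omega)
    have h2 := lintegral_layer_le hP act z (k := m) (by omega)
      (fun w => gatedState act w z (τ w) m) (fun j => hτ.measurable_gatedState act z m j)
      (fun w w' hw => gatedState_congr act z m hw (hτ.congr w w' m hw))
    have h3 : stateEnergy act P z τ (m + 1) ≤
        ENNReal.ofReal (act.p * d * σ ^ 2) * stateEnergy act P z τ m := by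
      refine le_of_eq_of_le (lintegral_congr fun w => ?_) h2
      simp only [gatedState_succ, h m hm (by omega) w]
    refine h3.trans ?_
    rw [Nat.succ_sub hm, pow_succ' _ (m - k), mul_assoc (ENNReal.ofReal _)]
    gcongr

/-- The elementary matrix at `c` moves entry `c.2` to place `c.1` and kills the rest. Gates are at
most `1`, and the free choice of `c.1` gives the factor `d`. -/
theorem sum_gatedState_setLayer_sq_le (act : Activation) {L d : ℕ} (w w' : WeightIndex L d → ℝ)
    (z : Fin d → ℝ) (ℓ : Fin L) :
    ∑ c : Fin d × Fin d, ∑ j, gatedState act w z (setLayer w' ℓ (unitWeight (ℓ, c))) (ℓ + 1) j ^ 2 ≤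
      d * ∑ j, gatedState act w z w' ℓ j ^ 2 := by
  have h1 : ∀ c : Fin d × Fin d, ∑ j,
      gatedState act w z (setLayer w' ℓ (unitWeight (ℓ, c))) (ℓ + 1) j ^ 2 ≤
        gatedState act w z w' ℓ c.2 ^ 2 := by
    intro c
    have h2 : gatedState act w z (setLayer w' ℓ (unitWeight (ℓ, c))) ℓ =
        gatedState act w z w' ℓ := by
      funext j
      simp only [gatedState, gatedForward_setLayer_of_le _ _ _ _ le_rfl]
    have h3 := weightMatrix_unitWeight_mulVec (ℓ, c) (gatedState act w z w' ℓ)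
    simp only at h3
    simp only [gatedState_succ, h2, weightMatrix_setLayer_self, h3, mul_pow, act.gate_sq]
    rw [Finset.sum_eq_single c.1 (by intro b _ hb; simp [hb]) (by simp)]
    rw [if_pos rfl]
    exact mul_le_of_le_one_left (sq_nonneg _) (act.gate_le_one _)
  refine (Finset.sum_le_sum fun c _ => h1 c).trans ?_
  rw [Fintype.sum_prod_type]
  simp

/-- The replaced layer costs `d`, and each of the `k - (ℓ + 1)` untouched layers above it costs `p d
σ²`. Allowing a modification `τ` below `ℓ` lets the bound be applied twice for second derivatives.
-/
theorem sum_stateEnergy_setLayer_le {L d : ℕ} {P : Measure ℝ} {σ : ℝ} [IsProbabilityMeasure P]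
    (hP : IsInitLaw P σ) (act : Activation) (z : Fin d → ℝ)
    {τ : (WeightIndex L d → ℝ) → WeightIndex L d → ℝ} (hτ : IsCausal τ) (ℓ : Fin L) {k : ℕ}
    (hℓ : ℓ < k) (hk : k ≤ L)
    (h : ∀ j : ℕ, ℓ < j → j < k → ∀ w, weightMatrix (τ w) j = weightMatrix w j) :
    ∑ c : Fin d × Fin d, stateEnergy act P z (fun w => setLayer (τ w) ℓ (unitWeight (ℓ, c))) k ≤
      ENNReal.ofReal (act.p * d * σ ^ 2) ^ (k - (ℓ + 1)) * (d * stateEnergy act P z τ ℓ) := by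
  calc ∑ c : Fin d × Fin d, stateEnergy act P z (fun w => setLayer (τ w) ℓ (unitWeight (ℓ, c))) k
      ≤ ∑ c : Fin d × Fin d, ENNReal.ofReal (act.p * d * σ ^ 2) ^ (k - (ℓ + 1)) *
          stateEnergy act P z (fun w => setLayer (τ w) ℓ (unitWeight (ℓ, c))) (ℓ + 1) :=
        Finset.sum_le_sum fun c _ => stateEnergy_le_pow_mul hP act z (hτ.setLayer ℓ _) hℓ hk
          fun j hj hj' w => by
            rw [weightMatrix_setLayer_of_ne _ _ (by omega : j ≠ ℓ.val)]
            exact h j hj hj' w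
    _ ≤ _ := by
        rw [← Finset.mul_sum]
        gcongr
        simp only [stateEnergy]
        rw [← lintegral_finsetSum, ← lintegral_const_mul]
        · refine lintegral_mono fun w => ?_
          rw [← ENNReal.ofReal_sum_of_nonneg fun c _ => Finset.sum_nonneg fun j _ => sq_nonneg _,
            ← ENNReal.ofReal_natCast, ← ENNReal.ofReal_mul (by positivity)]
          exact ENNReal.ofReal_le_ofReal (sum_gatedState_setLayer_sq_le act w (τ w) z ℓ)
        · exact ENNReal.measurable_ofReal.comp (Finset.measurable_fun_sum _ fun j _ =>
            (hτ.measurable_gatedState act z _ j).pow_const 2)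
        · exact fun c _ => ENNReal.measurable_ofReal.comp (Finset.measurable_fun_sum _ fun j _ =>
            ((hτ.setLayer ℓ _).measurable_gatedState act z _ j).pow_const 2)

theorem stateEnergy_id_le {L d : ℕ} {P : Measure ℝ} {σ : ℝ} [IsProbabilityMeasure P]
    (hP : IsInitLaw P σ) (act : Activation) (z : Fin d → ℝ) {k : ℕ} (hk : k ≤ L) :
    stateEnergy act P z (id : (WeightIndex L d → ℝ) → _) k ≤
      ENNReal.ofReal (act.p * d * σ ^ 2) ^ k * ENNReal.ofReal (∑ j, z j ^ 2) := by
  refine (stateEnergy_le_pow_mul hP act z isCausal_id (Nat.zero_le k) hk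
    fun _ _ _ _ => rfl).trans ?_
  rw [Nat.sub_zero]
  gcongr
  calc stateEnergy act P z (id : (WeightIndex L d → ℝ) → _) 0
      ≤ ∫⁻ _ : WeightIndex L d → ℝ, ENNReal.ofReal (∑ j, z j ^ 2) ∂Measure.pi (fun _ => P) := by
        refine lintegral_mono fun w => ENNReal.ofReal_le_ofReal (Finset.sum_le_sum fun j _ => ?_)
        simp only [gatedState, gates, gatedForward, mul_pow, act.gate_sq]
        exact mul_le_of_le_one_left (sq_nonneg _) (act.gate_le_one _)
    _ = _ := by simp

theorem sum_stateEnergy_setLayer_id_le {L d : ℕ} {P : Measure ℝ} {σ : ℝ}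
    [IsProbabilityMeasure P] (hP : IsInitLaw P σ) (act : Activation) (z : Fin d → ℝ) (ℓ : Fin L)
    {k : ℕ} (hℓ : ℓ < k) (hk : k ≤ L) :
    ∑ c : Fin d × Fin d, stateEnergy act P z (fun w => setLayer w ℓ (unitWeight (ℓ, c))) k ≤
      d * ENNReal.ofReal (act.p * d * σ ^ 2) ^ (k - 1) * ENNReal.ofReal (∑ j, z j ^ 2) := by
  refine (sum_stateEnergy_setLayer_le hP act z isCausal_id ℓ hℓ hk fun _ _ _ _ => rfl).trans ?_
  calc _ ≤ ENNReal.ofReal (act.p * d * σ ^ 2) ^ (k - (ℓ + 1)) *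
        (d * (ENNReal.ofReal (act.p * d * σ ^ 2) ^ ℓ.val * ENNReal.ofReal (∑ j, z j ^ 2))) := by
        gcongr
        exact stateEnergy_id_le hP act z ℓ.isLt.le
    _ = _ := by
        rw [show k - 1 = (k - (ℓ + 1)) + ℓ by omega, pow_add]
        ring

/-- The upper replacement `m` is peeled off first, since everything above it is random. What remains
is a single replacement in a network that ends at layer `m`, and the exponents `L - (m + 1)` and `m
- 1` add up to `L - 2`. -/
theorem sum_stateEnergy_setLayer_setLayer_le_of_lt {L d : ℕ} {P : Measure ℝ} {σ : ℝ}
    [IsProbabilityMeasure P] (hP : IsInitLaw P σ) (act : Activation) (z : Fin d → ℝ)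
    {ℓ m : Fin L} (hℓm : ℓ < m) :
    ∑ c : Fin d × Fin d, ∑ c' : Fin d × Fin d, stateEnergy act P z
        (fun w => setLayer (setLayer w ℓ (unitWeight (ℓ, c))) m (unitWeight (m, c'))) L ≤
      d ^ 2 * ENNReal.ofReal (act.p * d * σ ^ 2) ^ (L - 2) * ENNReal.ofReal (∑ j, z j ^ 2) := by
  have hlt : ℓ.val < m.val := hℓm
  calc _ ≤ ∑ c : Fin d × Fin d, ENNReal.ofReal (act.p * d * σ ^ 2) ^ (L - (m + 1)) *
        (d * stateEnergy act P z (fun w => setLayer w ℓ (unitWeight (ℓ, c))) m) :=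
        Finset.sum_le_sum fun c _ => sum_stateEnergy_setLayer_le hP act z
          (isCausal_id.setLayer ℓ _) m m.isLt le_rfl fun j hj _ w =>
            weightMatrix_setLayer_of_ne _ _ (by omega)
    _ ≤ ENNReal.ofReal (act.p * d * σ ^ 2) ^ (L - (m + 1)) * (d *
        (d * ENNReal.ofReal (act.p * d * σ ^ 2) ^ (m.val - 1) *
          ENNReal.ofReal (∑ j, z j ^ 2))) := by
        rw [← Finset.mul_sum, ← Finset.mul_sum]
        gcongr
        exact sum_stateEnergy_setLayer_id_le hP act z ℓ hlt m.isLt.le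
    _ = _ := by
        rw [show L - 2 = (L - (m + 1)) + (m - 1) by have := m.isLt; omega, pow_add]
        ring

theorem sum_stateEnergy_setLayer_setLayer_le {L d : ℕ} {P : Measure ℝ} {σ : ℝ}
    [IsProbabilityMeasure P] (hP : IsInitLaw P σ) (act : Activation) (z : Fin d → ℝ)
    {ℓ m : Fin L} (hℓm : ℓ ≠ m) :
    ∑ c : Fin d × Fin d, ∑ c' : Fin d × Fin d, stateEnergy act P z
        (fun w => setLayer (setLayer w ℓ (unitWeight (ℓ, c))) m (unitWeight (m, c'))) L ≤
      d ^ 2 * ENNReal.ofReal (act.p * d * σ ^ 2) ^ (L - 2) * ENNReal.ofReal (∑ j, z j ^ 2) := by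
  rcases lt_or_gt_of_ne hℓm with h | h
  · exact sum_stateEnergy_setLayer_setLayer_le_of_lt hP act z h
  · rw [Finset.sum_comm]
    simp only [fun w u v => setLayer_comm (d := d) w u v hℓm]
    exact sum_stateEnergy_setLayer_setLayer_le_of_lt hP act z h

theorem lastStateSq_nonneg (act : Activation) {L d : ℕ} (w : WeightIndex L d → ℝ) (z : Fin d → ℝ)
    (w' : WeightIndex L d → ℝ) : 0 ≤ lastStateSq act w z w' :=
  Finset.sum_nonneg fun _ _ => sq_nonneg _

theorem measurable_lastStateSq (act : Activation) {L d : ℕ} {β : Type*} [MeasurableSpace β]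
    {f h : β → WeightIndex L d → ℝ} {g : β → Fin d → ℝ} (hf : Measurable f) (hg : Measurable g)
    (hh : Measurable h) : Measurable fun x => lastStateSq act (f x) (g x) (h x) := by
  simp only [lastStateSq]
  exact Finset.measurable_fun_sum _ fun j _ =>
    ((measurable_gatedState act L j).comp ((hf.prodMk hg).prodMk hh)).pow_const 2

theorem measurable_derivativeEnergy (act : Activation) {L d : ℕ} (α : ℝ) {β : Type*}
    [MeasurableSpace β] {f : β → WeightIndex L d → ℝ} {g : β → Fin d → ℝ} (hf : Measurable f)
    (hg : Measurable g) : Measurable fun x => derivativeEnergy act α (f x) (g x) := by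
  simp only [derivativeEnergy]
  have h1 : Measurable fun x => ∑ a : WeightIndex L d,
      lastStateSq act (f x) (g x) (setLayer (f x) a.1 (unitWeight a)) :=
    Finset.measurable_fun_sum _ fun a _ =>
      measurable_lastStateSq act hf hg ((measurable_setLayer _ _).comp hf)
  have h2 : Measurable fun x => lastStateSq act (f x) (g x) (f x) :=
    measurable_lastStateSq act hf hg hf
  have h3 : Measurable fun x => ∑ a : WeightIndex L d, ∑ b : WeightIndex L d,
      if a.1 = b.1 then 0 else lastStateSq act (f x) (g x)
        (setLayer (setLayer (f x) a.1 (unitWeight a)) b.1 (unitWeight b)) := by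
    refine Finset.measurable_fun_sum _ fun a _ => Finset.measurable_fun_sum _ fun b _ => ?_
    split_ifs
    · exact measurable_const
    · exact measurable_lastStateSq act hf hg
        ((measurable_setLayer _ _).comp ((measurable_setLayer _ _).comp hf))
  exact (h1.add (h2.const_mul α)).add (h3.const_mul α⁻¹)

/-- The powers `s^(L-1)` and `s^(L-2)` are written as quotients, which avoids truncated subtraction
for `L < 2`, where the corresponding sums can be empty. -/
theorem lintegral_derivativeEnergy_le {L d : ℕ} {P : Measure ℝ} {σ s α : ℝ}
    [IsProbabilityMeasure P] (hP : IsInitLaw P σ) (act : Activation) (hα : 0 < α)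
    (hs : s = act.p * d * σ ^ 2) (hs0 : 0 < s) (z : Fin d → ℝ) :
    ∫⁻ w : WeightIndex L d → ℝ, ENNReal.ofReal (derivativeEnergy act α w z)
        ∂Measure.pi (fun _ => P) ≤
      ENNReal.ofReal ((L * d * (s ^ L / s) + α * s ^ L + α⁻¹ * (L ^ 2 * d ^ 2 * (s ^ L / s ^ 2))) *
        ∑ j, z j ^ 2) := by
  have hz : 0 ≤ ∑ j, z j ^ 2 := Finset.sum_nonneg fun _ _ => sq_nonneg _
  set Z := ∑ j, z j ^ 2 with hZ
  have hmeas : ∀ τ : (WeightIndex L d → ℝ) → WeightIndex L d → ℝ, Measurable τ →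
      Measurable fun w => ENNReal.ofReal (lastStateSq act w z (τ w)) := fun τ hτ =>
    (measurable_lastStateSq act measurable_id measurable_const hτ).ennreal_ofReal
  have h1 : ∫⁻ w : WeightIndex L d → ℝ, ENNReal.ofReal (∑ a,
      lastStateSq act w z (setLayer w a.1 (unitWeight a))) ∂Measure.pi (fun _ => P) ≤
      ENNReal.ofReal (L * d * (s ^ L / s) * Z) := by
    simp only [ENNReal.ofReal_sum_of_nonneg fun a _ => lastStateSq_nonneg act _ z _]
    rw [lintegral_finsetSum _ fun a _ => hmeas _ (measurable_setLayer _ _), Fintype.sum_prod_type]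
    have h2 : ∀ ℓ : Fin L, ∑ c : Fin d × Fin d, ∫⁻ w : WeightIndex L d → ℝ, ENNReal.ofReal
        (lastStateSq act w z (setLayer w ℓ (unitWeight (ℓ, c)))) ∂Measure.pi (fun _ => P) ≤
        ENNReal.ofReal (d * (s ^ L / s) * Z) := by
      intro ℓ
      refine (sum_stateEnergy_setLayer_id_le hP act z ℓ ℓ.isLt le_rfl).trans (le_of_eq ?_)
      have hL : 1 ≤ L := by have := ℓ.isLt; omega
      rw [← hs, ← hZ, ENNReal.ofReal_mul (by positivity), ENNReal.ofReal_mul (by positivity),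
        ENNReal.ofReal_natCast, ← ENNReal.ofReal_pow hs0.le]
      congr 3
      rw [eq_div_iff hs0.ne', ← pow_succ, Nat.sub_add_cancel hL]
    refine (Finset.sum_le_sum fun ℓ _ => h2 ℓ).trans (le_of_eq ?_)
    rw [Finset.sum_const, Finset.card_univ, Fintype.card_fin, nsmul_eq_mul,
      ← ENNReal.ofReal_natCast, ← ENNReal.ofReal_mul (by positivity)]
    congr 1
    ring
  have h2 : ∫⁻ w : WeightIndex L d → ℝ, ENNReal.ofReal (α * lastStateSq act w z w)
      ∂Measure.pi (fun _ => P) ≤ ENNReal.ofReal (α * s ^ L * Z) := by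
    simp only [ENNReal.ofReal_mul hα.le]
    rw [lintegral_const_mul _ (hmeas (fun w => w) measurable_id'), mul_assoc, ENNReal.ofReal_mul hα.le]
    gcongr
    refine (stateEnergy_id_le hP act z le_rfl).trans (le_of_eq ?_)
    rw [← hs, ← hZ, ENNReal.ofReal_mul (by positivity), ENNReal.ofReal_pow hs0.le]
  have h3 : ∫⁻ w : WeightIndex L d → ℝ, ENNReal.ofReal (α⁻¹ * ∑ a, ∑ b, if a.1 = b.1 then 0 else
      lastStateSq act w z (setLayer (setLayer w a.1 (unitWeight a)) b.1 (unitWeight b)))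
      ∂Measure.pi (fun _ => P) ≤
      ENNReal.ofReal (α⁻¹ * (L ^ 2 * d ^ 2 * (s ^ L / s ^ 2)) * Z) := by
    have hnn : ∀ (w : WeightIndex L d → ℝ) (a b : WeightIndex L d), 0 ≤ if a.1 = b.1 then 0 else
      lastStateSq act w z (setLayer (setLayer w a.1 (unitWeight a)) b.1 (unitWeight b)) := by
      intro w a b
      split_ifs
      · exact le_rfl
      · exact lastStateSq_nonneg _ _ _ _
    have hm2 : ∀ a b : WeightIndex L d, Measurable fun w : WeightIndex L d → ℝ =>
        ENNReal.ofReal (if a.1 = b.1 then 0 else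
          lastStateSq act w z (setLayer (setLayer w a.1 (unitWeight a)) b.1 (unitWeight b))) := by
      intro a b
      split_ifs
      · exact measurable_const
      · exact hmeas _ ((measurable_setLayer _ _).comp (measurable_setLayer _ _))
    simp only [ENNReal.ofReal_mul (inv_pos.mpr hα).le,
      ENNReal.ofReal_sum_of_nonneg fun a _ => Finset.sum_nonneg fun b _ => hnn _ a b,
      ENNReal.ofReal_sum_of_nonneg fun b _ => hnn _ _ b]
    rw [lintegral_const_mul _ (Finset.measurable_fun_sum _ fun a _ =>
      Finset.measurable_fun_sum _ fun b _ => hm2 a b), mul_assoc α⁻¹,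
      ENNReal.ofReal_mul (inv_pos.mpr hα).le]
    gcongr
    rw [lintegral_finsetSum _ fun a _ => Finset.measurable_fun_sum _ fun b _ => hm2 a b]
    simp only [fun a : WeightIndex L d => lintegral_finsetSum (μ := Measure.pi fun _ => P)
      (Finset.univ) fun b _ => hm2 a b]
    rw [Fintype.sum_prod_type]
    simp only [Fintype.sum_prod_type (α₁ := Fin L)]
    have h4 : ∀ ℓ m : Fin L, ∑ c : Fin d × Fin d, ∑ c' : Fin d × Fin d,
        ∫⁻ w : WeightIndex L d → ℝ, ENNReal.ofReal (if ℓ = m then 0 else lastStateSq act w z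
          (setLayer (setLayer w ℓ (unitWeight (ℓ, c))) m (unitWeight (m, c'))))
          ∂Measure.pi (fun _ => P) ≤ ENNReal.ofReal (d ^ 2 * (s ^ L / s ^ 2) * Z) := by
      intro ℓ m
      by_cases hℓm : ℓ = m
      · simp [hℓm]
      · simp only [if_neg hℓm]
        refine (sum_stateEnergy_setLayer_setLayer_le hP act z hℓm).trans (le_of_eq ?_)
        -- Two distinct layers exist, so `L - 2` is a genuine difference.
        have hL : 2 ≤ L := by
          have := ℓ.isLt
          have := m.isLt
          have : ℓ.val ≠ m.val := fun h => hℓm (Fin.ext h)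
          omega
        rw [← hs, ← hZ, ENNReal.ofReal_mul (by positivity), ENNReal.ofReal_mul (by positivity),
          ENNReal.ofReal_pow (by positivity), ENNReal.ofReal_natCast, ← ENNReal.ofReal_pow hs0.le]
        congr 3
        rw [eq_div_iff (by positivity), ← pow_add, Nat.sub_add_cancel hL]
    calc _ = ∑ ℓ : Fin L, ∑ m : Fin L, ∑ c : Fin d × Fin d, ∑ c' : Fin d × Fin d,
        ∫⁻ w : WeightIndex L d → ℝ, ENNReal.ofReal (if ℓ = m then 0 else lastStateSq act w z
          (setLayer (setLayer w ℓ (unitWeight (ℓ, c))) m (unitWeight (m, c'))))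
          ∂Measure.pi (fun _ => P) := Finset.sum_congr rfl fun ℓ _ => Finset.sum_comm
      _ ≤ ∑ ℓ : Fin L, ∑ m : Fin L, ENNReal.ofReal (d ^ 2 * (s ^ L / s ^ 2) * Z) :=
        Finset.sum_le_sum fun ℓ _ => Finset.sum_le_sum fun m _ => h4 ℓ m
      _ = _ := by
        simp only [Finset.sum_const, Finset.card_univ, Fintype.card_fin, nsmul_eq_mul]
        rw [← ENNReal.ofReal_natCast, ← ENNReal.ofReal_mul (by positivity),
          ← ENNReal.ofReal_mul (by positivity)]
        congr 1
        ring
  have hm1 : Measurable fun w : WeightIndex L d → ℝ => ENNReal.ofReal (∑ a,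
      lastStateSq act w z (setLayer w a.1 (unitWeight a))) := by
    simp only [ENNReal.ofReal_sum_of_nonneg fun a _ => lastStateSq_nonneg act _ z _]
    exact Finset.measurable_fun_sum _ fun a _ => hmeas _ (measurable_setLayer _ _)
  have hm2 : Measurable fun w : WeightIndex L d → ℝ =>
      ENNReal.ofReal (α * lastStateSq act w z w) := by
    simp only [ENNReal.ofReal_mul hα.le]
    exact (hmeas (fun w => w) measurable_id').const_mul _
  rw [add_mul, add_mul, ENNReal.ofReal_add (by positivity) (by positivity),
    ENNReal.ofReal_add (by positivity) (by positivity)]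
  refine (lintegral_mono fun w => ENNReal.ofReal_add_le.trans
    (add_le_add_left ENNReal.ofReal_add_le _)).trans ?_
  rw [lintegral_add_left (hm1.fun_add hm2), lintegral_add_left hm1]
  exact add_le_add (add_le_add h1 h2) h3

/-! ### Expectation over the network and choice of `α` -/

namespace RandomNetwork

variable {L d : ℕ} {P : Measure ℝ}

theorem map_W (N : RandomNetwork.{u} L d P) : N.μ.map N.W = Measure.pi fun _ => P := by
  have h := (iIndepFun_iff_map_fun_eq_pi_map fun a => (N.measurable_W a).aemeasurable).mp N.indep_W
  simpa only [N.law_W] using h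

/-- The pair of the input and the output matrix. -/
def outerPair (N : RandomNetwork.{u} L d P) (ω : N.Ω) :
    (Fin d → Fin N.din → ℝ) × (Fin N.dout → Fin d → ℝ) :=
  (fun i j => N.A ω i j, fun i j => N.B ω i j)

theorem measurable_outerPair (N : RandomNetwork.{u} L d P) : Measurable N.outerPair :=
  (measurable_pi_lambda _ fun i => measurable_pi_lambda _ fun j => N.measurable_A i j).prodMk
    (measurable_pi_lambda _ fun i => measurable_pi_lambda _ fun j => N.measurable_B i j)

theorem measurable_weights (N : RandomNetwork.{u} L d P) : Measurable N.W :=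
  measurable_pi_lambda _ N.measurable_W

/-- Tonelli's theorem for functions of the outer matrices and of the hidden weights. -/
theorem lintegral_eq_lintegral_pi [IsProbabilityMeasure P] (N : RandomNetwork.{u} L d P)
    (F : ((Fin d → Fin N.din → ℝ) × (Fin N.dout → Fin d → ℝ)) × (WeightIndex L d → ℝ) → ℝ≥0∞)
    (hF : Measurable F) :
    ∫⁻ ω, F (N.outerPair ω, N.W ω) ∂N.μ =
      ∫⁻ ω, ∫⁻ w, F (N.outerPair ω, w) ∂Measure.pi (fun _ => P) ∂N.μ := by
  have h := (indepFun_iff_map_prod_eq_prod_map_map N.measurable_outerPair.aemeasurable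
    N.measurable_weights.aemeasurable).mp N.indep_AB_W
  rw [N.map_W] at h
  rw [← lintegral_map hF (N.measurable_outerPair.prodMk N.measurable_weights), h,
    lintegral_prod _ hF.aemeasurable, lintegral_map hF.lintegral_prod_right' N.measurable_outerPair]

/-- The outer matrices are independent of the hidden weights and can be frozen. The inner integral
then yields a deterministic factor times `‖A x‖²`, and only the expectation of `‖B‖_F² ‖A x‖²` is
left. -/
theorem lintegral_mul_derivativeEnergy_le [IsProbabilityMeasure P] {σ s α K : ℝ}
    (N : RandomNetwork.{u} L d P) (hP : IsInitLaw P σ) (act : Activation) (hN : N.BoundedBy K)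
    (hα : 0 < α) (hs : s = act.p * d * σ ^ 2) (hs0 : 0 < s) (i : Fin N.n) :
    ∫⁻ ω, ENNReal.ofReal ((∑ o, ∑ j, N.B ω o j ^ 2) *
        derivativeEnergy act α (N.W ω) (N.A ω *ᵥ N.x i)) ∂N.μ ≤
      ENNReal.ofReal ((L * d * (s ^ L / s) + α * s ^ L +
        α⁻¹ * (L ^ 2 * d ^ 2 * (s ^ L / s ^ 2))) * K ^ 2) := by
  set κ := L * d * (s ^ L / s) + α * s ^ L + α⁻¹ * (L ^ 2 * d ^ 2 * (s ^ L / s ^ 2)) with hκ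
  have hκ0 : 0 ≤ κ := by positivity
  have hb : ∀ ω, 0 ≤ ∑ o, ∑ j, N.B ω o j ^ 2 := fun ω => by positivity
  have hmA : Measurable fun q : ((Fin d → Fin N.din → ℝ) × (Fin N.dout → Fin d → ℝ)) ×
      (WeightIndex L d → ℝ) => Matrix.of q.1.1 *ᵥ N.x i := by
    refine measurable_pi_lambda _ fun j => ?_
    simp only [Matrix.mulVec, dotProduct, Matrix.of_apply]
    fun_prop
  have h1 := N.lintegral_eq_lintegral_pi (fun q => ENNReal.ofReal ((∑ o, ∑ j, q.1.2 o j ^ 2) *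
    derivativeEnergy act α q.2 (Matrix.of q.1.1 *ᵥ N.x i)))
    (Measurable.mul (by fun_prop)
      (measurable_derivativeEnergy act α measurable_snd hmA)).ennreal_ofReal
  refine h1.le.trans ?_
  calc _ ≤ ∫⁻ ω, ENNReal.ofReal κ * ENNReal.ofReal ((∑ o, ∑ j, N.B ω o j ^ 2) *
        ∑ j, (N.A ω *ᵥ N.x i) j ^ 2) ∂N.μ := by
        refine lintegral_mono fun ω => ?_
        have h2 := lintegral_derivativeEnergy_le (L := L) hP act hα hs hs0 (N.A ω *ᵥ N.x i)
        rw [← hκ] at h2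
        have h3 : ∀ w : WeightIndex L d → ℝ, ENNReal.ofReal ((∑ o, ∑ j, N.B ω o j ^ 2) *
            derivativeEnergy act α w (N.A ω *ᵥ N.x i)) =
            ENNReal.ofReal (∑ o, ∑ j, N.B ω o j ^ 2) *
              ENNReal.ofReal (derivativeEnergy act α w (N.A ω *ᵥ N.x i)) := fun w =>
          ENNReal.ofReal_mul (hb ω)
        refine (lintegral_congr h3).le.trans ?_
        rw [lintegral_const_mul _
          (measurable_derivativeEnergy act α measurable_id' measurable_const).ennreal_ofReal]
        refine (mul_le_mul_right h2 _).trans (le_of_eq ?_)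
        rw [ENNReal.ofReal_mul hκ0, ENNReal.ofReal_mul (hb ω)]
        ring
    _ ≤ ENNReal.ofReal κ * ENNReal.ofReal (K ^ 2) := by
        rw [lintegral_const_mul' _ _ ENNReal.ofReal_ne_top]
        gcongr
        exact hN.outer i
    _ = _ := (ENNReal.ofReal_mul hκ0).symm

theorem expectedMaxEigenvalue_le_of_pos [IsProbabilityMeasure P] {σ s α K : ℝ}
    (N : RandomNetwork.{u} L d P) (hP : IsInitLaw P σ) (act : Activation) (hN : N.BoundedBy K)
    (hα : 0 < α) (hs : s = act.p * d * σ ^ 2) (hs0 : 0 < s) :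
    N.expectedMaxEigenvalue act ≤ ENNReal.ofReal ((α + (L * d * (s ^ L / s) + α * s ^ L +
        α⁻¹ * (L ^ 2 * d ^ 2 * (s ^ L / s ^ 2)))) * K ^ 2) := by
  set κ := L * d * (s ^ L / s) + α * s ^ L + α⁻¹ * (L ^ 2 * d ^ 2 * (s ^ L / s ^ 2)) with hκ
  have hκ0 : 0 ≤ κ := by positivity
  have hm : ∀ i, Measurable fun ω => ENNReal.ofReal ((∑ o, ∑ j, N.B ω o j ^ 2) *
      derivativeEnergy act α (N.W ω) (N.A ω *ᵥ N.x i)) := by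
    intro i
    have hA := N.measurable_A
    have hB := N.measurable_B
    have hmA : Measurable fun ω => N.A ω *ᵥ N.x i := by
      refine measurable_pi_lambda _ fun j => ?_
      simp only [Matrix.mulVec, dotProduct]
      fun_prop
    exact (Measurable.mul (by fun_prop)
      (measurable_derivativeEnergy act α N.measurable_weights hmA)).ennreal_ofReal
  have hn : (0 : ℝ) ≤ (N.n : ℝ)⁻¹ := by positivity
  calc N.expectedMaxEigenvalue act
      ≤ ∫⁻ ω, ENNReal.ofReal (N.n : ℝ)⁻¹ * ∑ i, (ENNReal.ofReal (α * K ^ 2) +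
          ENNReal.ofReal ((∑ o, ∑ j, N.B ω o j ^ 2) *
            derivativeEnergy act α (N.W ω) (N.A ω *ᵥ N.x i))) ∂N.μ := by
        -- Monotonicity of the lower Lebesgue integral holds for all functions, so the spectral
        -- radius need not be measurable in `ω`.
        refine lintegral_mono fun ω =>
          (spectralRadius_networkHessian_le act (N.A ω) (N.B ω) N.x N.y (N.W ω) hα).trans ?_
        rw [ENNReal.ofReal_mul hn]
        gcongr
        refine (Finset.le_sum_of_subadditive _ ENNReal.ofReal_zero.le
          (fun _ _ => ENNReal.ofReal_add_le) _ _).trans (Finset.sum_le_sum fun i _ => ?_)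
        refine ENNReal.ofReal_add_le.trans (add_le_add_left (ENNReal.ofReal_le_ofReal ?_) _)
        exact mul_le_mul_of_nonneg_left (hN.target i) hα.le
    _ = ENNReal.ofReal (N.n : ℝ)⁻¹ * ∑ i, (ENNReal.ofReal (α * K ^ 2) +
          ∫⁻ ω, ENNReal.ofReal ((∑ o, ∑ j, N.B ω o j ^ 2) *
            derivativeEnergy act α (N.W ω) (N.A ω *ᵥ N.x i)) ∂N.μ) := by
        rw [lintegral_const_mul' _ _ ENNReal.ofReal_ne_top,
          lintegral_finsetSum _ fun i _ => measurable_const.fun_add (hm i)]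
        congr 1
        refine Finset.sum_congr rfl fun i _ => ?_
        rw [lintegral_add_left measurable_const, lintegral_const, measure_univ, mul_one]
    _ ≤ ENNReal.ofReal (N.n : ℝ)⁻¹ * ∑ _i : Fin N.n, ENNReal.ofReal ((α + κ) * K ^ 2) := by
        gcongr with i
        rw [add_mul, ENNReal.ofReal_add (by positivity) (by positivity)]
        gcongr
        exact N.lintegral_mul_derivativeEnergy_le hP act hN hα hs hs0 i
    _ ≤ ENNReal.ofReal ((α + κ) * K ^ 2) := by
        rw [Finset.sum_const, Finset.card_univ, Fintype.card_fin, nsmul_eq_mul, ← mul_assoc,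
          ← ENNReal.ofReal_natCast, ← ENNReal.ofReal_mul hn]
        -- The factor `n⁻¹ * n` is `1`, or `0` for an empty data set.
        refine mul_le_of_le_one_left zero_le ?_
        rw [ENNReal.ofReal_le_one]
        exact inv_mul_le_one

/-- The optimization over `α`. The depth enters the constant only through `M ^ L`, which disappears
for `M = 1`. -/
theorem expectedMaxEigenvalue_le {σ K s₀ M : ℝ} (N : RandomNetwork.{u} L d P)
    (hP : IsInitLaw P σ) (act : Activation) (hN : N.BoundedBy K) (hs₀ : 0 < s₀) (hM : 1 ≤ M)
    (h₀ : s₀ ≤ act.p * d * σ ^ 2) (h₁ : act.p * d * σ ^ 2 ≤ M) :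
    N.expectedMaxEigenvalue act ≤
      ENNReal.ofReal (L * d * (((1 + M ^ L / s₀ + M ^ L + 1 / s₀ ^ 2) * K ^ 2) *
        (act.p * d * σ ^ 2) ^ ((L : ℝ) / 2))) := by
  have := hP.isProbabilityMeasure
  obtain ⟨s, hs⟩ : ∃ s, s = act.p * d * σ ^ 2 := ⟨_, rfl⟩
  rw [← hs] at h₀ h₁ ⊢
  have hs0 : 0 < s := hs₀.trans_le h₀
  have hd : (0 : ℝ) < d := by
    rcases Nat.eq_zero_or_pos d with rfl | h
    · simp at hs
      exact absurd hs hs0.ne'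
    · exact_mod_cast h
  -- Depth `0` is separate because `α` would be `0`; the Hessian is then an empty matrix.
  rcases Nat.eq_zero_or_pos L with rfl | hL
  · refine le_of_eq_of_le ?_ zero_le
    refine (lintegral_congr fun ω => ?_).trans lintegral_zero
    refine le_antisymm ((spectralRadius_le_of_quadratic_form _ 0 fun v hv => ?_).trans (by simp))
      zero_le
    simp at hv
  have hL' : (0 : ℝ) < L := by exact_mod_cast hL
  set q := s ^ ((L : ℝ) / 2) with hq
  have hq0 : 0 < q := Real.rpow_pos_of_pos hs0 _
  have hqq : q * q = s ^ L := by
    rw [hq, ← Real.rpow_add hs0, add_halves, Real.rpow_natCast]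
  have hsM : s ^ L ≤ M ^ L := pow_le_pow_left₀ hs0.le h₁ L
  have hM1 : 1 ≤ M ^ L := one_le_pow₀ hM
  -- From `q * q ≤ M ^ L` and `1 ≤ M ^ L`; this is where `1 ≤ M` matters.
  have hqM : q ≤ M ^ L := by nlinarith
  -- With `q = s^(L/2)` this `α` balances the target term `α` against the second-derivative term
  -- `α⁻¹ L² d² q² / s²`: both become `L d q` up to a factor depending on `s`.
  refine (N.expectedMaxEigenvalue_le_of_pos hP act hN (α := L * d * q) (by positivity) hs
    hs0).trans (ENNReal.ofReal_le_ofReal ?_)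
  have e1 : s ^ L / s ≤ q * (M ^ L / s₀) := by
    rw [← hqq, mul_div_assoc]
    gcongr
  have e2 : (L * d * q)⁻¹ * (L ^ 2 * d ^ 2 * (s ^ L / s ^ 2)) ≤ L * d * (q * (1 / s₀ ^ 2)) := by
    rw [← hqq]
    have : (L * d * q)⁻¹ * (L ^ 2 * d ^ 2 * (q * q / s ^ 2)) = L * d * (q * (1 / s ^ 2)) := by
      field_simp
    rw [this]
    gcongr
  have e3 : L * d * q * s ^ L ≤ L * d * q * M ^ L := by gcongr
  have e4 : L * d * (s ^ L / s) ≤ L * d * (q * (M ^ L / s₀)) := by gcongr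
  calc _ ≤ (L * d * q + (L * d * (q * (M ^ L / s₀)) + L * d * q * M ^ L +
        L * d * (q * (1 / s₀ ^ 2)))) * K ^ 2 := by gcongr
    _ = _ := by ring

end RandomNetwork

/-! ### Local constancy of the gates and smoothness of the true loss -/

theorem preact_eq_gatedForward (act : Activation) {L d : ℕ} (w : WeightIndex L d → ℝ)
    (z : Fin d → ℝ) (k : ℕ) : preact act w z k = gatedForward (gates act w z) w z k := by
  induction k with
  | zero => rfl
  | succ k ih => simp only [preact, gatedForward, ← ih, gates, act.gate_mul_self]

theorem mlpLoss_eq_gatedLoss (act : Activation) {L d din dout n : ℕ}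
    (A : Matrix (Fin d) (Fin din) ℝ) (B : Matrix (Fin dout) (Fin d) ℝ)
    (x : Fin n → Fin din → ℝ) (y : Fin n → Fin dout → ℝ) {w₀ w : WeightIndex L d → ℝ}
    (h : ∀ i, ∀ k ≤ L, gates act w (A *ᵥ x i) k = gates act w₀ (A *ᵥ x i) k) :
    mlpLoss act A B x y w = gatedLoss act A B x y w₀ w := by
  have h1 : ∀ i, (fun j => act.fn (preact act w (A *ᵥ x i) L j)) = fun j =>
      gates act w₀ (A *ᵥ x i) L j * gatedForward (gates act w₀ (A *ᵥ x i)) w (A *ᵥ x i) L j := by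
    intro i
    funext j
    rw [← h i L le_rfl, ← gatedForward_congr (A *ᵥ x i) L (fun k hk => h i k hk.le)
      (fun a _ => rfl), ← preact_eq_gatedForward, ← act.gate_mul_self]
    rfl
  simp only [mlpLoss, h1]
  rfl

theorem Activation.continuous_fn (act : Activation) : Continuous act.fn := by
  cases act
  · exact continuous_id
  · exact continuous_id.max continuous_const

theorem continuous_preact (act : Activation) {L d : ℕ} (z : Fin d → ℝ) (k : ℕ) (j : Fin d) :
    Continuous fun w : WeightIndex L d → ℝ => preact act w z k j := by
  induction k generalizing j with
  | zero => exact continuous_const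
  | succ k ih =>
    simp only [preact, Matrix.mulVec, dotProduct, weightMatrix, Matrix.of_apply]
    refine continuous_finsetSum _ fun i _ => Continuous.mul ?_ (act.continuous_fn.comp (ih i))
    split_ifs
    · exact continuous_apply _
    · exact continuous_const

/-- Every preactivation is nonzero, unless all inputs of the neuron vanish. -/
def IsNondegenerate (act : Activation) {L d : ℕ} (w : WeightIndex L d → ℝ) (z : Fin d → ℝ) :
    Prop :=
  ∀ k < L, ∀ j j', act.fn (preact act w z k j') = 0 ∨ preact act w z (k + 1) j ≠ 0

/-- A layer may die completely with positive probability, so preactivations equal to `0` cannot be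
excluded. If one occurs, nondegeneracy makes all inputs of the neuron inactive. Each comes from a
strictly negative preactivation, which stays negative nearby, or inductively from one that is
locally zero; hence the neuron is locally zero as well. -/
theorem IsNondegenerate.preact_ne_zero_or {L d : ℕ} {w₀ : WeightIndex L d → ℝ} {z : Fin d → ℝ}
    (h : IsNondegenerate .relu w₀ z) {k : ℕ} (hk : k ≤ L) (j : Fin d) :
    preact .relu w₀ z k j ≠ 0 ∨ ∀ᶠ w in 𝓝 w₀, preact .relu w z k j = 0 := by
  induction k generalizing j with
  | zero =>
    by_cases hz : z j = 0
    · exact Or.inr (Filter.Eventually.of_forall fun _ => hz)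
    · exact Or.inl hz
  | succ k ih =>
    by_cases h0 : preact .relu w₀ z (k + 1) j = 0
    · right
      have h1 : ∀ j', ∀ᶠ w in 𝓝 w₀, Activation.relu.fn (preact .relu w z k j') = 0 := by
        intro j'
        have hfn := (h k (by omega) j j').resolve_right (not_not.mpr h0)
        rcases ih (by omega) j' with h2 | h2
        · have h3 : preact .relu w₀ z k j' < 0 :=
            lt_of_le_of_ne (by simpa [Activation.fn] using hfn) h2
          filter_upwards [(continuous_preact .relu z k j').continuousAt.eventually_lt_const h3]
            with w hw
          exact max_eq_right hw.le
        · filter_upwards [h2] with w hw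
          simp [hw, Activation.fn]
      filter_upwards [Filter.eventually_all.mpr h1] with w hw
      simp [preact, hw, Matrix.mulVec, dotProduct]
    · exact Or.inl h0

/-- At a nondegenerate point the gates are locally constant. -/
theorem IsNondegenerate.eventually_gates_eq {act : Activation} {L d : ℕ}
    {w₀ : WeightIndex L d → ℝ} {z : Fin d → ℝ}
    (h : act = .linear ∨ IsNondegenerate act w₀ z) :
    ∀ᶠ w in 𝓝 w₀, ∀ k ≤ L, gates act w z k = gates act w₀ z k := by
  cases act with
  | linear => exact Filter.Eventually.of_forall fun w k _ => rfl
  | relu =>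
    have h' : IsNondegenerate .relu w₀ z := h.resolve_left (by simp)
    refine (Filter.eventually_all_finite (Set.finite_Iic L)).mpr fun k hk => ?_
    have h1 : ∀ j, ∀ᶠ w in 𝓝 w₀, gates .relu w z k j = gates .relu w₀ z k j := by
      intro j
      have hc := (continuous_preact (L := L) .relu z k j).continuousAt (x := w₀)
      rcases h'.preact_ne_zero_or hk j with h2 | h2
      · rcases lt_or_gt_of_ne h2 with h3 | h3
        · filter_upwards [hc.eventually_lt_const h3] with w hw
          simp [gates, Activation.gate, not_lt.mpr hw.le, not_lt.mpr h3.le]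
        · filter_upwards [hc.eventually_const_lt h3] with w hw
          simp [gates, Activation.gate, hw, h3]
      · filter_upwards [h2] with w hw
        simp [gates, hw, h2.self_of_nhds]
    filter_upwards [Filter.eventually_all.mpr h1] with w hw
    exact funext hw

theorem contDiff_gatedLoss (act : Activation) {L d din dout n : ℕ}
    (A : Matrix (Fin d) (Fin din) ℝ) (B : Matrix (Fin dout) (Fin d) ℝ)
    (x : Fin n → Fin din → ℝ) (y : Fin n → Fin dout → ℝ) (w₀ : WeightIndex L d → ℝ)
    {m : WithTop ℕ∞} : ContDiff ℝ m (gatedLoss act A B x y w₀) :=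
  contDiff_const.mul (ContDiff.sum fun i _ => ContDiff.sum fun o _ =>
    (contDiff_const.sub (contDiff_gatedOutput B (gates act w₀ (A *ᵥ x i)) (A *ᵥ x i) o)).pow 2)

theorem contDiffAt_mlpLoss_and_hessianMatrix_eq (act : Activation) {L d din dout n : ℕ}
    (A : Matrix (Fin d) (Fin din) ℝ) (B : Matrix (Fin dout) (Fin d) ℝ)
    (x : Fin n → Fin din → ℝ) (y : Fin n → Fin dout → ℝ) (w₀ : WeightIndex L d → ℝ)
    (h : ∀ i, act = .linear ∨ IsNondegenerate act w₀ (A *ᵥ x i)) :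
    ContDiffAt ℝ 2 (mlpLoss act A B x y) w₀ ∧
      hessianMatrix (mlpLoss act A B x y) w₀ = networkHessian act A B x y w₀ := by
  have h1 : mlpLoss act A B x y =ᶠ[𝓝 w₀] gatedLoss act A B x y w₀ := by
    filter_upwards [Filter.eventually_all.mpr fun i => IsNondegenerate.eventually_gates_eq (h i)]
      with w hw
    exact mlpLoss_eq_gatedLoss act A B x y hw
  refine ⟨(contDiff_gatedLoss act A B x y w₀).contDiffAt.congr_of_eventuallyEq h1, ?_⟩
  ext a b
  simp only [hessianMatrix, networkHessian, Matrix.of_apply]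
  rw [(h1.iteratedFDeriv ℝ 2).eq_of_nhds]

/-! ### Almost sure nondegeneracy for atomless laws -/

/-- With all other weights frozen, the preactivation is an affine function `t * c + r` of the weight
joining `j'` to `j`, where `c` is the activation of `j'`. If `c ≠ 0` it vanishes for one value of
`t` only, and that value is not an atom. -/
theorem ae_preact_ne_zero {L d : ℕ} {P : Measure ℝ} [IsProbabilityMeasure P]
    (hP : ∀ t : ℝ, P {t} = 0) (act : Activation) (z : Fin d → ℝ) {k : ℕ} (hk : k < L)
    (j j' : Fin d) : ∀ᵐ w : WeightIndex L d → ℝ ∂Measure.pi (fun _ => P),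
      act.fn (preact act w z k j') = 0 ∨ preact act w z (k + 1) j ≠ 0 := by
  have hm : ∀ k i, Measurable fun w : WeightIndex L d → ℝ => preact act w z k i := fun k i =>
    (continuous_preact act z k i).measurable
  set T : Set (WeightIndex L d → ℝ) :=
    {w | act.fn (preact act w z k j') = 0 ∨ preact act w z (k + 1) j ≠ 0} with hT
  have hTm : MeasurableSet T :=
    (measurableSet_eq_fun (act.measurable_fn.comp (hm k j')) measurable_const).union
      (measurableSet_eq_fun (hm (k + 1) j) measurable_const).compl
  change Measure.pi (fun _ => P) Tᶜ = 0
  rw [← lintegral_indicator_one hTm.compl]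
  refine le_antisymm ?_ zero_le
  refine (lintegral_le_of_lmarginal_le (g := 0) {((⟨k, hk⟩, j, j') : WeightIndex L d)}
    (measurable_const.indicator hTm.compl) measurable_const ?_).trans (by simp)
  rw [lmarginal_singleton]
  intro w
  refine le_of_eq_of_le ?_ zero_le
  set a : WeightIndex L d := (⟨k, hk⟩, j, j') with ha
  have h1 : ∀ t, preact act (Function.update w a t) z k = preact act w z k := fun t =>
    preact_congr act z k fun b hb => by
      rw [Function.update_of_ne]
      rintro rfl
      exact lt_irrefl _ hb
  set c := act.fn (preact act w z k j') with hc
  set r := ∑ i ∈ Finset.univ.erase j', w (⟨k, hk⟩, j, i) * act.fn (preact act w z k i) with hr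
  have h2 : ∀ t, preact act (Function.update w a t) z (k + 1) j = t * c + r := by
    intro t
    simp only [preact, h1, Matrix.mulVec, dotProduct, weightMatrix, Matrix.of_apply, hk, dif_pos]
    rw [← Finset.add_sum_erase _ _ (Finset.mem_univ j')]
    congr 1
    · rw [← ha, Function.update_self]
    · refine Finset.sum_congr rfl fun i hi => ?_
      rw [Function.update_of_ne]
      intro h
      rw [ha] at h
      exact (Finset.mem_erase.mp hi).1 (congrArg (fun b : WeightIndex L d => b.2.2) h)
  have h3 : (fun t => Tᶜ.indicator (1 : (WeightIndex L d → ℝ) → ℝ≥0∞) (Function.update w a t)) ≤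
      ({-r / c} : Set ℝ).indicator 1 := by
    intro t
    by_cases ht : Function.update w a t ∈ Tᶜ
    · have h4 : ¬ (c = 0 ∨ t * c + r ≠ 0) := by
        rw [hT, Set.mem_compl_iff, Set.mem_ofPred_eq, h1, h2] at ht
        exact ht
      push Not at h4
      have h5 : t = -r / c := by
        rw [eq_div_iff h4.1]
        linarith [h4.2]
      simp [← h5, Set.indicator_of_mem ht]
    · simp [Set.indicator_of_notMem ht]
  refine le_antisymm ((lintegral_mono h3).trans ?_) zero_le
  rw [lintegral_indicator_one (measurableSet_singleton _), hP]

namespace RandomNetwork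

variable {L d : ℕ} {P : Measure ℝ}

theorem ae_mem_of_forall_ae [IsProbabilityMeasure P] (N : RandomNetwork.{u} L d P)
    {T : Set (((Fin d → Fin N.din → ℝ) × (Fin N.dout → Fin d → ℝ)) × (WeightIndex L d → ℝ))}
    (hT : MeasurableSet T) (h : ∀ ω, ∀ᵐ w ∂Measure.pi (fun _ => P), (N.outerPair ω, w) ∈ T) :
    ∀ᵐ ω ∂N.μ, (N.outerPair ω, N.W ω) ∈ T := by
  have h1 := N.lintegral_eq_lintegral_pi (Tᶜ.indicator fun _ => 1) (measurable_const.indicator hT.compl)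
  have h2 : ∀ ω, ∫⁻ w, Tᶜ.indicator (fun _ => (1 : ℝ≥0∞)) (N.outerPair ω, w)
      ∂Measure.pi (fun _ => P) = 0 := by
    intro ω
    refine lintegral_eq_zero_of_ae_eq_zero ?_
    filter_upwards [h ω] with w hw
    exact Set.indicator_of_notMem (s := Tᶜ) (not_not.mpr hw) _
  simp only [h2, lintegral_zero] at h1
  have hm : Measurable fun ω => Tᶜ.indicator (fun _ => (1 : ℝ≥0∞)) (N.outerPair ω, N.W ω) :=
    (measurable_const.indicator hT.compl).comp
      (N.measurable_outerPair.prodMk N.measurable_weights)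
  rw [lintegral_eq_zero_iff hm] at h1
  filter_upwards [h1] with ω hω
  by_contra hmem
  simp [Set.indicator_of_mem (show (N.outerPair ω, N.W ω) ∈ Tᶜ from hmem)] at hω

theorem ae_isNondegenerate [IsProbabilityMeasure P] (N : RandomNetwork.{u} L d P)
    (hP : ∀ t : ℝ, P {t} = 0) (act : Activation) (i : Fin N.n) :
    ∀ᵐ ω ∂N.μ, IsNondegenerate act (N.W ω) (N.A ω *ᵥ N.x i) := by
  have h1 : ∀ k : Fin L, ∀ j j' : Fin d, ∀ᵐ ω ∂N.μ,
      act.fn (preact act (N.W ω) (N.A ω *ᵥ N.x i) k j') = 0 ∨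
        preact act (N.W ω) (N.A ω *ᵥ N.x i) (k + 1) j ≠ 0 := by
    intro k j j'
    have hmA : Measurable fun q : ((Fin d → Fin N.din → ℝ) × (Fin N.dout → Fin d → ℝ)) ×
        (WeightIndex L d → ℝ) => Matrix.of q.1.1 *ᵥ N.x i := by
      refine measurable_pi_lambda _ fun j => ?_
      simp only [Matrix.mulVec, dotProduct, Matrix.of_apply]
      fun_prop
    have hm : ∀ k i', Measurable fun q : ((Fin d → Fin N.din → ℝ) × (Fin N.dout → Fin d → ℝ)) ×
        (WeightIndex L d → ℝ) => preact act q.2 (Matrix.of q.1.1 *ᵥ N.x i) k i' := fun k i' =>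
      (measurable_preact act k i').comp (measurable_snd.prodMk hmA)
    exact N.ae_mem_of_forall_ae
      (T := {q | act.fn (preact act q.2 (Matrix.of q.1.1 *ᵥ N.x i) k j') = 0 ∨
        preact act q.2 (Matrix.of q.1.1 *ᵥ N.x i) (k + 1) j ≠ 0})
      ((measurableSet_eq_fun (act.measurable_fn.comp (hm k j')) measurable_const).union
        (measurableSet_eq_fun (hm (k + 1) j) measurable_const).compl)
      fun ω => ae_preact_ne_zero hP act (N.A ω *ᵥ N.x i) k.isLt j j'
  have h2 := ae_all_iff.mpr fun k => ae_all_iff.mpr fun j => ae_all_iff.mpr fun j' => h1 k j j'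
  filter_upwards [h2] with ω hω k hk j j'
  exact hω ⟨k, hk⟩ j j'

end RandomNetwork

theorem corollary1 (act : Activation) :
    -- depth-uniform bound in the vanishing or stable regime `p d σ² ≤ 1`
    (∀ K s₀ : ℝ, 0 < s₀ → ∃ C : ℝ, 0 ≤ C ∧
      ∀ (L d : ℕ) (P : Measure ℝ) (σ : ℝ) (N : RandomNetwork.{u} L d P),
        IsInitLaw P σ → N.BoundedBy K →
        s₀ ≤ act.p * d * σ ^ 2 → act.p * d * σ ^ 2 ≤ 1 →
        N.expectedMaxEigenvalue act ≤
          ENNReal.ofReal (L * d * (C * (act.p * d * σ ^ 2) ^ ((L : ℝ) / 2)))) ∧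
    -- width-uniform bound at each fixed depth, for `p d σ²` in any bounded range
    (∀ K s₀ s₁ : ℝ, 0 < s₀ → ∀ L : ℕ, ∃ C : ℝ, 0 ≤ C ∧
      ∀ (d : ℕ) (P : Measure ℝ) (σ : ℝ) (N : RandomNetwork.{u} L d P),
        IsInitLaw P σ → N.BoundedBy K →
        s₀ ≤ act.p * d * σ ^ 2 → act.p * d * σ ^ 2 ≤ s₁ →
        N.expectedMaxEigenvalue act ≤
          ENNReal.ofReal (L * d * (C * (act.p * d * σ ^ 2) ^ ((L : ℝ) / 2)))) ∧
    -- for linear networks, and for ReLU networks with an atomless weight law, the loss is almost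
    -- surely twice differentiable at the initialization, with the Hessian used above
    (∀ (L d : ℕ) (P : Measure ℝ) (σ : ℝ) (N : RandomNetwork.{u} L d P), IsInitLaw P σ →
      (act = Activation.linear ∨ ∀ t : ℝ, P {t} = 0) →
      ∀ᵐ ω ∂N.μ, ContDiffAt ℝ 2 (N.loss act ω) (N.W ω) ∧
        hessianMatrix (N.loss act ω) (N.W ω) = N.hessian act ω) := by
  refine ⟨fun K s₀ hs₀ => ?_, fun K s₀ s₁ hs₀ L => ?_, fun L d P σ N hP hact => ?_⟩
  -- This is the case `M = 1`, in which every `M ^ L` is `1`.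
  · refine ⟨(1 + 1 / s₀ + 1 + 1 / s₀ ^ 2) * K ^ 2, by positivity,
      fun L d P σ N hP hN h₀ h₁ => ?_⟩
    simpa only [one_pow] using N.expectedMaxEigenvalue_le hP act hN hs₀ le_rfl h₀ h₁
  -- The maximum with `1` ensures `1 ≤ M` even when `s₁ < 1`.
  · exact ⟨(1 + max 1 s₁ ^ L / s₀ + max 1 s₁ ^ L + 1 / s₀ ^ 2) * K ^ 2, by positivity,
      fun d P σ N hP hN h₀ h₁ =>
        N.expectedMaxEigenvalue_le hP act hN hs₀ (le_max_left _ _) h₀ (h₁.trans (le_max_right _ _))⟩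
  · have := hP.isProbabilityMeasure
    have h1 : ∀ᵐ ω ∂N.μ, ∀ i, act = .linear ∨
        IsNondegenerate act (N.W ω) (N.A ω *ᵥ N.x i) := by
      rcases hact with h | h
      · exact Filter.Eventually.of_forall fun _ _ => Or.inl h
      · filter_upwards [ae_all_iff.mpr (N.ae_isNondegenerate h act)] with ω hω i
        exact Or.inr (hω i)
    filter_upwards [h1] with ω hω
    exact contDiffAt_mlpLoss_and_hessianMatrix_eq act (N.A ω) (N.B ω) N.x N.y (N.W ω) hω
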